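/- Let $L>0$, let $a,b,c>0$ be constants and let $p\in L^1[0,L]$ be nonnegative (almost everywhere). Consider the Melan problem $$w''''(x)-\Big(a+b\int_0^L w\,dt\Big)w''(x)+c\int_0^L w\,dt=p(x)\quad\text{for a.e. }x\in(0,L),\qquad w(0)=w(L)=w''(0)=w''(L)=0, \tag{P}$$ with solutions sought in $W^{4,1}[0,L]$. A function $\alpha\in W^{4,1}[0,L]$ with $\alpha(0)=\alpha(L)=\alpha''(0)=\alpha''(L)=0$ is a lower (upper) solution of (P) if the equation holds a.e. with $=$ replaced by $\le$ (by $\ge$). Put $$\sigma(z)=\frac{3z^3}{6z\cosh z+6z-12\sinh z-z^3}\qquad(z>0).$$ Suppose that for some $\lambda>0$ $$p(x)\le\Big[\lambda\frac{\pi^4}{L^4}+a\lambda\frac{\pi^2}{L^2}+2b\lambda^2\frac{\pi}{L}\Big]\sin\Big(\frac{\pi x}{L}\Big)+2\lambda c\frac{L}{\pi}\quad\text{for a.e. }x\in(0,L)$$ and $$N\le\frac{4M}{L^3}\,\sigma(\sqrt M\,L),\qquad M:=a+2b\lambda\frac{L}{\pi},\quad N:=c+b\lambda\frac{\pi^2}{L^2}.$$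 Then $\alpha\equiv0$ is a lower solution and $\beta(x)=\lambda\sin(\pi x/L)$ is an upper solution of (P), and $M=a+b\int_0^L\beta\,dx$, $N=c-b\min_{[0,L]}\beta''$. Moreover, for each of the initial functions $y_0=\alpha$ and $y_0=\beta$ the iterative procedure $$y_n''''-My_n''+N\int_0^L y_n\,dt=p+ay_{n-1}''+b\,y_{n-1}''\int_0^L y_{n-1}\,dt-c\int_0^L y_{n-1}\,dt-My_{n-1}''+N\int_0^L y_{n-1}\,dt\quad\text{a.e. in }(0,L),$$ $$y_n(0)=y_n(L)=y_n''(0)=y_n''(L)=0,\qquad n=1,2,\dots,$$ determines a unique sequence in $W^{4,1}[0,L]$; call these sequences $(\alpha_n)$ and $(\beta_n)$. On $[0,L]$ they satisfy, for all $n\ge0$, $\alpha_n\le\alpha_{n+1}$, $\alpha_n\le\beta_n$, $\beta_{n+1}\le\beta_n$ and $\alpha_n''\ge\alpha_{n+1}''$, $\alpha_n''\ge\beta_n''$, $\beta_{n+1}''\ge\beta_n''$. Finally, (P) has solutions $\underline y$ and $\overline y$ in $$[0,\beta]:=\{u\in C^2[0,L]:\ 0\le u\le\beta,\ \ 0\ge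 u''\ge\beta''\}$$ that are its minimum and maximum solutions there, that is, $\underline y\le y\le\overline y$ and $\underline y''\ge y''\ge\overline y''$ for every solution $y\in[0,\beta]$ of (P), and $\alpha_n\to\underline y$, $\beta_n\to\overline y$ uniformly on $[0,L]$. -/

import Mathlib

open MeasureTheory Set Filter

noncomputable section

namespace Melan

/-- The `k`-th derivative of `y` on the interval `[0, L]` (one-sided at the end points). -/
def D (L : ℝ) (k : ℕ) (y : ℝ → ℝ) : ℝ → ℝ := iteratedDerivWithin k y (Icc 0 L)

/-- `y ∈ W^{4,1}[0, L]`, for the continuous representative: `y` is three times continuously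
differentiable on `[0, L]` and `y'''` is absolutely continuous there (so that `y''''` exists
almost everywhere, is integrable, and is the weak derivative of `y'''`). -/
def MemW41 (L : ℝ) (y : ℝ → ℝ) : Prop :=
  ContDiffOn ℝ 3 y (Icc 0 L) ∧ AbsolutelyContinuousOnInterval (D L 3 y) 0 L

/-- Navier boundary conditions `y(0) = y(L) = y''(0) = y''(L) = 0`. -/
def NavierBC (L : ℝ) (y : ℝ → ℝ) : Prop :=
  y 0 = 0 ∧ y L = 0 ∧ D L 2 y 0 = 0 ∧ D L 2 y L = 0

/-- The left-hand side `y'''' - (a + b ∫₀ᴸ y) y'' + c ∫₀ᴸ y` of the Melan equation. -/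
def melanOp (a b c L : ℝ) (y : ℝ → ℝ) (x : ℝ) : ℝ :=
  D L 4 y x - (a + b * ∫ t in (0 : ℝ)..L, y t) * D L 2 y x + c * ∫ t in (0 : ℝ)..L, y t

/-- Solutions of the Melan boundary value problem. -/
def IsSolution (a b c L : ℝ) (p y : ℝ → ℝ) : Prop :=
  MemW41 L y ∧ NavierBC L y ∧ ∀ᵐ x ∂volume.restrict (Ioo 0 L), melanOp a b c L y x = p x

/-- Lower solutions of the Melan boundary value problem. -/
def IsLowerSolution (a b c L : ℝ) (p y : ℝ → ℝ) : Prop :=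
  MemW41 L y ∧ NavierBC L y ∧ ∀ᵐ x ∂volume.restrict (Ioo 0 L), melanOp a b c L y x ≤ p x

/-- Upper solutions of the Melan boundary value problem. -/
def IsUpperSolution (a b c L : ℝ) (p y : ℝ → ℝ) : Prop :=
  MemW41 L y ∧ NavierBC L y ∧ ∀ᵐ x ∂volume.restrict (Ioo 0 L), p x ≤ melanOp a b c L y x

/-- The order used in the monotone method: `u ≤ v` and `u'' ≥ v''` on `[0, L]`. -/
def Below (L : ℝ) (u v : ℝ → ℝ) : Prop :=
  ∀ x ∈ Icc 0 L, u x ≤ v x ∧ D L 2 v x ≤ D L 2 u x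

/-- `u ∈ [α, β]`: `u ∈ C²[0, L]`, `α ≤ u ≤ β` and `α'' ≥ u'' ≥ β''`. -/
def InSector (L : ℝ) (α β u : ℝ → ℝ) : Prop :=
  ContDiffOn ℝ 2 u (Icc 0 L) ∧ Below L α u ∧ Below L u β

/-- `y` is the minimum solution in `[α, β]`. -/
def IsMinSolution (a b c L : ℝ) (p α β y : ℝ → ℝ) : Prop :=
  IsSolution a b c L p y ∧ InSector L α β y ∧
    ∀ z, IsSolution a b c L p z → InSector L α β z → Below L y z

/-- `y` is the maximum solution in `[α, β]`. -/
def IsMaxSolution (a b c L : ℝ) (p α β y : ℝ → ℝ) : Prop :=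
  IsSolution a b c L p y ∧ InSector L α β y ∧
    ∀ z, IsSolution a b c L p z → InSector L α β z → Below L z y

/-- `f(x, ∫₀ᴸ y, y''(x)) = p(x) + a y''(x) + b y''(x) ∫₀ᴸ y - c ∫₀ᴸ y`. -/
def rhs (a b c L : ℝ) (p y : ℝ → ℝ) (x : ℝ) : ℝ :=
  p x + a * D L 2 y x + b * D L 2 y x * (∫ t in (0 : ℝ)..L, y t) - c * ∫ t in (0 : ℝ)..L, y t

/-- The linear operator `G w = w'''' - M w'' + N ∫₀ᴸ w`. -/
def linOp (M N L : ℝ) (w : ℝ → ℝ) (x : ℝ) : ℝ :=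
  D L 4 w x - M * D L 2 w x + N * ∫ t in (0 : ℝ)..L, w t

/-- One step `y ↦ z` of the iterative procedure: `z ∈ W^{4,1}[0, L]` satisfies the Navier
conditions and `G z = f(x, ∫₀ᴸ y, y'') - M y'' + N ∫₀ᴸ y` almost everywhere in `(0, L)`. -/
def IsStep (a b c L M N : ℝ) (p y z : ℝ → ℝ) : Prop :=
  MemW41 L z ∧ NavierBC L z ∧ ∀ᵐ x ∂volume.restrict (Ioo 0 L),
    linOp M N L z x = rhs a b c L p y x - M * D L 2 y x + N * ∫ t in (0 : ℝ)..L, y t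

/-- `y 0, y 1, …` (as functions on `[0, L]`) is produced by the iterative procedure started
at `y₀`. -/
def IsIteration (a b c L M N : ℝ) (p y₀ : ℝ → ℝ) (y : ℕ → ℝ → ℝ) : Prop :=
  EqOn (y 0) y₀ (Icc 0 L) ∧ ∀ n, IsStep a b c L M N p (y n) (y (n + 1))

/-- `y` is the sequence produced by the iterative procedure started at `y₀`, the only one as
far as the values on `[0, L]` are concerned. -/
def IsTheIteration (a b c L M N : ℝ) (p y₀ : ℝ → ℝ) (y : ℕ → ℝ → ℝ) : Prop :=
  IsIteration a b c L M N p y₀ y ∧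
    ∀ z, IsIteration a b c L M N p y₀ z → ∀ n, EqOn (z n) (y n) (Icc 0 L)

/-- `σ(z) = 3 z³ / (6 z cosh z + 6 z - 12 sinh z - z³)`; the denominator is positive for
`z > 0`. -/
def sigma (z : ℝ) : ℝ :=
  3 * z ^ 3 / (6 * z * Real.cosh z + 6 * z - 12 * Real.sinh z - z ^ 3)

end Melan

end

/-!
Write `M = m²` and `I = ∫₀ᴸ w`. Under Navier conditions `u = -w''` solves a Dirichlet problem
`-u'' + m² u = G w - N I`, and `I` is the integral of `u` against the parabola `x (L - x) / 2`.
Testing the equation with the response to that parabola eliminates `I`, so `-w''` is the integral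
of `G w` against a rank one perturbation `navierGreen` of the Dirichlet Green function. The product
subtracted there is largest, relative to the Green function, in the limit at the corners `(0, L)`
and `(L, 0)`, and `N ≤ 4 M / L³ σ(√M L)` says exactly that the kernel stays nonnegative in this
limit. Hence `G` obeys a maximum principle for the order `u ≤ v`, `u'' ≥ v''`. The constants `M`
and `N` are chosen so that the right-hand side of the iteration is monotone for this order below
`β`; the iterates from `0` and `β` are therefore monotone, and dominated convergence shows that
their limits are solutions, which bound every solution in between.
-/

namespace Melan

open Real (sinh cosh)

open scoped Topology

section Interval

variable {E : Type*} [NormedAddCommGroup E] {s t : ℝ} {f g : ℝ → E}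

lemma ae_uIoc_of_ae_Ioo {P : ℝ → Prop} (hst : s ≤ t) (h : ∀ᵐ x ∂volume.restrict (Ioo s t), P x) :
    ∀ᵐ x ∂volume.restrict (uIoc s t), P x := by
  rwa [uIoc_of_le hst, ← Measure.restrict_congr_set Ioo_ae_eq_Ioc]

lemma integral_congr_ae_Ioo [NormedSpace ℝ E] (hst : s ≤ t)
    (h : ∀ᵐ x ∂volume.restrict (Ioo s t), f x = g x) : ∫ x in s..t, f x = ∫ x in s..t, g x :=
  intervalIntegral.integral_congr_ae_restrict (ae_uIoc_of_ae_Ioo hst h)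

lemma intervalIntegrable_congr_ae_Ioo (hst : s ≤ t) (hf : IntervalIntegrable f volume s t)
    (h : ∀ᵐ x ∂volume.restrict (Ioo s t), f x = g x) : IntervalIntegrable g volume s t :=
  hf.congr_ae (ae_uIoc_of_ae_Ioo hst h)

lemma absolutelyContinuousOnInterval_congr (hf : AbsolutelyContinuousOnInterval f s t)
    (h : EqOn f g (uIcc s t)) : AbsolutelyContinuousOnInterval g s t := by
  refine Tendsto.congr' ?_ hf
  filter_upwards [mem_inf_of_right (mem_principal_self _)] with I hI
  refine Finset.sum_congr rfl fun i hi => ?_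
  rw [h (hI.1 i hi).1, h (hI.1 i hi).2]

end Interval

section Derivatives

variable {L : ℝ} {y f f' : ℝ → ℝ} {k : ℕ} {x : ℝ}

@[simp]
lemma D_zero (L : ℝ) (y : ℝ → ℝ) : D L 0 y = y := iteratedDerivWithin_zero

lemma D_succ (L : ℝ) (k : ℕ) (y : ℝ → ℝ) :
    D L (k + 1) y = derivWithin (D L k y) (Icc 0 L) := iteratedDerivWithin_succ

lemma D_succ_eq_deriv (k : ℕ) (y : ℝ → ℝ) (hx : x ∈ Ioo 0 L) :
    D L (k + 1) y x = deriv (D L k y) x := by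
  rw [D_succ, derivWithin_of_mem_nhds (Icc_mem_nhds hx.1 hx.2)]

lemma D_congr (k : ℕ) (h : EqOn y f (Icc 0 L)) : EqOn (D L k y) (D L k f) (Icc 0 L) :=
  iteratedDerivWithin_congr h

lemma D_eq_iteratedDeriv (hL : 0 < L) (hy : ContDiff ℝ k y) (hx : x ∈ Icc 0 L) :
    D L k y x = iteratedDeriv k y x :=
  iteratedDerivWithin_eq_iteratedDeriv (uniqueDiffOn_Icc hL) hy.contDiffAt hx

lemma eqOn_D_succ (hL : 0 < L) (h : EqOn (D L k y) f (Icc 0 L))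
    (hf : ∀ x ∈ Icc 0 L, HasDerivWithinAt f (f' x) (Icc 0 L) x) :
    EqOn (D L (k + 1) y) f' (Icc 0 L) := fun x hx => by
  rw [D_succ, derivWithin_congr h (h hx)]
  exact (hf x hx).derivWithin (uniqueDiffOn_Icc hL x hx)

lemma hasDerivWithinAt_D (hL : 0 < L) {n : ℕ} (hy : ContDiffOn ℝ n y (Icc 0 L)) (hk : k < n)
    (hx : x ∈ Icc 0 L) : HasDerivWithinAt (D L k y) (D L (k + 1) y x) (Icc 0 L) x := by
  rw [D_succ]
  exact (hy.differentiableOn_iteratedDerivWithin (by exact_mod_cast hk)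
    (uniqueDiffOn_Icc hL) x hx).hasDerivWithinAt

lemma continuousOn_D (hL : 0 < L) {n : ℕ} (hy : ContDiffOn ℝ n y (Icc 0 L)) (hk : k ≤ n) :
    ContinuousOn (D L k y) (Icc 0 L) :=
  hy.continuousOn_iteratedDerivWithin (by exact_mod_cast hk) (uniqueDiffOn_Icc hL)

lemma contDiffOn_succ_of_hasDerivWithinAt {s : Set ℝ} {n : ℕ} (hs : UniqueDiffOn ℝ s)
    (hf : ∀ x ∈ s, HasDerivWithinAt f (f' x) s x) (hf' : ContDiffOn ℝ n f' s) :
    ContDiffOn ℝ (n + 1) f s :=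
  (contDiffOn_succ_iff_derivWithin hs).2 ⟨fun x hx => (hf x hx).differentiableWithinAt,
    fun h => absurd h (by simp), hf'.congr fun x hx => (hf x hx).derivWithin (hs x hx)⟩

lemma memW41_of_contDiffOn (hL : 0 < L) (hy : ContDiffOn ℝ 4 y (Icc 0 L)) : MemW41 L y := by
  refine ⟨hy.of_le (by norm_num), ContDiffOn.absolutelyContinuousOnInterval ?_⟩
  rw [uIcc_of_le hL.le]
  exact contDiffOn_succ_of_hasDerivWithinAt (n := 0) (uniqueDiffOn_Icc hL)
    (fun x hx => hasDerivWithinAt_D hL (n := 4) hy (by norm_num) hx)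
    (contDiffOn_zero.2 (continuousOn_D hL (n := 4) hy le_rfl))

section

variable {w w₁ w₂ w₃ : ℝ → ℝ}

lemma eqOn_D_two (hL : 0 < L) (hw : ∀ x ∈ Icc 0 L, HasDerivWithinAt w (w₁ x) (Icc 0 L) x)
    (hw₁ : ∀ x ∈ Icc 0 L, HasDerivWithinAt w₁ (w₂ x) (Icc 0 L) x) :
    EqOn (D L 2 w) w₂ (Icc 0 L) :=
  eqOn_D_succ hL (eqOn_D_succ hL (k := 0) (by simp [EqOn]) hw) hw₁

lemma eqOn_D_three (hL : 0 < L) (hw : ∀ x ∈ Icc 0 L, HasDerivWithinAt w (w₁ x) (Icc 0 L) x)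
    (hw₁ : ∀ x ∈ Icc 0 L, HasDerivWithinAt w₁ (w₂ x) (Icc 0 L) x)
    (hw₂ : ∀ x ∈ Icc 0 L, HasDerivWithinAt w₂ (w₃ x) (Icc 0 L) x) :
    EqOn (D L 3 w) w₃ (Icc 0 L) :=
  eqOn_D_succ hL (eqOn_D_two hL hw hw₁) hw₂

lemma memW41_of_hasDerivWithinAt (hL : 0 < L)
    (hw : ∀ x ∈ Icc 0 L, HasDerivWithinAt w (w₁ x) (Icc 0 L) x)
    (hw₁ : ∀ x ∈ Icc 0 L, HasDerivWithinAt w₁ (w₂ x) (Icc 0 L) x)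
    (hw₂ : ∀ x ∈ Icc 0 L, HasDerivWithinAt w₂ (w₃ x) (Icc 0 L) x)
    (hac : AbsolutelyContinuousOnInterval w₃ 0 L) : MemW41 L w := by
  have hs := uniqueDiffOn_Icc hL
  have hw₃ : ContDiffOn ℝ 0 w₃ (Icc 0 L) :=
    contDiffOn_zero.2 (by simpa only [uIcc_of_le hL.le] using hac.continuousOn)
  refine ⟨?_, absolutelyContinuousOnInterval_congr hac ?_⟩
  · exact contDiffOn_succ_of_hasDerivWithinAt (n := 2) hs hw
      (contDiffOn_succ_of_hasDerivWithinAt (n := 1) hs hw₁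
        (contDiffOn_succ_of_hasDerivWithinAt (n := 0) hs hw₂ hw₃))
  · rw [uIcc_of_le hL.le]
    exact (eqOn_D_three hL hw hw₁ hw₂).symm

end

namespace MemW41

variable {u v : ℝ → ℝ}

lemma hasDerivWithinAt (hL : 0 < L) (hy : MemW41 L y) (hk : k < 3) (hx : x ∈ Icc 0 L) :
    HasDerivWithinAt (D L k y) (D L (k + 1) y x) (Icc 0 L) x :=
  hasDerivWithinAt_D hL (n := 3) hy.1 hk hx

lemma hasDerivWithinAt_self (hL : 0 < L) (hy : MemW41 L y) (hx : x ∈ Icc 0 L) :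
    HasDerivWithinAt y (D L 1 y x) (Icc 0 L) x := by
  simpa only [D_zero] using hy.hasDerivWithinAt hL (k := 0) (by norm_num) hx

lemma continuousOn_D (hL : 0 < L) (hy : MemW41 L y) (hk : k ≤ 3) :
    ContinuousOn (D L k y) (Icc 0 L) :=
  Melan.continuousOn_D hL (n := 3) hy.1 hk

lemma intervalIntegrable_D (hL : 0 < L) (hy : MemW41 L y) (hk : k ≤ 3) :
    IntervalIntegrable (D L k y) volume 0 L :=
  (hy.continuousOn_D hL hk).intervalIntegrable_of_Icc hL.le

lemma continuousOn (hy : MemW41 L y) : ContinuousOn y (Icc 0 L) := hy.1.continuousOn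

lemma intervalIntegrable (hL : 0 < L) (hy : MemW41 L y) : IntervalIntegrable y volume 0 L :=
  hy.continuousOn.intervalIntegrable_of_Icc hL.le

lemma intervalIntegrable_D_four (hL : 0 < L) (hy : MemW41 L y) :
    IntervalIntegrable (D L 4 y) volume 0 L := by
  refine intervalIntegrable_congr_ae_Ioo hL.le hy.2.intervalIntegrable_deriv ?_
  filter_upwards [ae_restrict_mem measurableSet_Ioo] with x hx
  exact (D_succ_eq_deriv 3 y hx).symm

lemma D_sub (hL : 0 < L) (hu : MemW41 L u) (hv : MemW41 L v) (hk : k ≤ 3) (hx : x ∈ Icc 0 L) :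
    D L k (u - v) x = D L k u x - D L k v x := by
  have hk' : (k : WithTop ℕ∞) ≤ 3 := by exact_mod_cast hk
  exact iteratedDerivWithin_sub hx (uniqueDiffOn_Icc hL) ((hu.1 x hx).of_le hk')
    ((hv.1 x hx).of_le hk')

lemma sub (hL : 0 < L) (hu : MemW41 L u) (hv : MemW41 L v) : MemW41 L (u - v) := by
  refine ⟨hu.1.sub hv.1, absolutelyContinuousOnInterval_congr (hu.2.sub hv.2) fun x hx => ?_⟩
  rw [uIcc_of_le hL.le] at hx
  exact (hu.D_sub hL hv le_rfl hx).symm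

lemma D_four_sub (hL : 0 < L) (hu : MemW41 L u) (hv : MemW41 L v) :
    ∀ᵐ x ∂volume.restrict (Ioo 0 L), D L 4 (u - v) x = D L 4 u x - D L 4 v x := by
  have hdu := hu.2.ae_differentiableAt
  have hdv := hv.2.ae_differentiableAt
  rw [uIcc_of_le hL.le] at hdu hdv
  filter_upwards [ae_restrict_mem measurableSet_Ioo, ae_restrict_of_ae hdu, ae_restrict_of_ae hdv]
    with x hx hxu hxv
  have hx' := Ioo_subset_Icc_self hx
  rw [D_succ_eq_deriv 3 _ hx, D_succ_eq_deriv 3 _ hx, D_succ_eq_deriv 3 _ hx,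
    ← deriv_sub (hxu hx') (hxv hx')]
  refine EventuallyEq.deriv_eq ?_
  filter_upwards [Icc_mem_nhds hx.1 hx.2] with t ht
  exact hu.D_sub hL hv le_rfl ht

end MemW41

lemma NavierBC.sub {u v : ℝ → ℝ} (hL : 0 < L) (hu : MemW41 L u) (hv : MemW41 L v)
    (hbu : NavierBC L u) (hbv : NavierBC L v) : NavierBC L (u - v) := by
  obtain ⟨hu0, huL, hu0', huL'⟩ := hbu
  obtain ⟨hv0, hvL, hv0', hvL'⟩ := hbv
  refine ⟨by simp [hu0, hv0], by simp [huL, hvL], ?_, ?_⟩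
  · rw [hu.D_sub hL hv (by norm_num) (left_mem_Icc.2 hL.le), hu0', hv0', sub_zero]
  · rw [hu.D_sub hL hv (by norm_num) (right_mem_Icc.2 hL.le), huL', hvL', sub_zero]

lemma linOp_sub {M N : ℝ} {u v : ℝ → ℝ} (hL : 0 < L) (hu : MemW41 L u) (hv : MemW41 L v) :
    ∀ᵐ x ∂volume.restrict (Ioo 0 L),
      linOp M N L (u - v) x = linOp M N L u x - linOp M N L v x := by
  filter_upwards [hu.D_four_sub hL hv, ae_restrict_mem measurableSet_Ioo] with x hx hx'
  simp only [linOp, hx, hu.D_sub hL hv (k := 2) (by norm_num) (Ioo_subset_Icc_self hx'),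
    Pi.sub_apply, intervalIntegral.integral_sub (hu.intervalIntegrable hL)
      (hv.intervalIntegrable hL)]
  ring

lemma intervalIntegrable_linOp (M N : ℝ) (hL : 0 < L) (hy : MemW41 L y) :
    IntervalIntegrable (linOp M N L y) volume 0 L :=
  ((hy.intervalIntegrable_D_four hL).sub
    ((hy.intervalIntegrable_D hL (by norm_num)).const_mul M)).add intervalIntegrable_const

end Derivatives

section Calculus

variable {s t x : ℝ} {f f₁ f₂ : ℝ → ℝ}

lemma concaveOn_Icc_of_deriv2_nonpos (hf : ∀ x ∈ Icc s t, HasDerivWithinAt f (f₁ x) (Icc s t) x)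
    (hf₁ : ∀ x ∈ Icc s t, HasDerivWithinAt f₁ (f₂ x) (Icc s t) x)
    (hf₂ : ∀ x ∈ Icc s t, f₂ x ≤ 0) : ConcaveOn ℝ (Icc s t) f :=
  concaveOn_of_hasDerivWithinAt2_nonpos (convex_Icc s t)
    (fun x hx => (hf x hx).continuousWithinAt)
    (fun x hx => (hf x (interior_subset hx)).mono interior_subset)
    (fun x hx => (hf₁ x (interior_subset hx)).mono interior_subset)
    (fun x hx => hf₂ x (interior_subset hx))

lemma nonneg_of_deriv2_nonpos (hf : ∀ x ∈ Icc s t, HasDerivWithinAt f (f₁ x) (Icc s t) x)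
    (hf₁ : ∀ x ∈ Icc s t, HasDerivWithinAt f₁ (f₂ x) (Icc s t) x)
    (hf₂ : ∀ x ∈ Icc s t, f₂ x ≤ 0) (hs : 0 ≤ f s) (ht : 0 ≤ f t) (hx : x ∈ Icc s t) :
    0 ≤ f x :=
  have hst := hx.1.trans hx.2
  (le_min hs ht).trans ((concaveOn_Icc_of_deriv2_nonpos hf hf₁ hf₂).min_le_of_mem_Icc
    (left_mem_Icc.2 hst) (right_mem_Icc.2 hst) hx)

lemma le_tangent_of_deriv2_nonpos (hf : ∀ x ∈ Icc s t, HasDerivWithinAt f (f₁ x) (Icc s t) x)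
    (hf₁ : ∀ x ∈ Icc s t, HasDerivWithinAt f₁ (f₂ x) (Icc s t) x)
    (hf₂ : ∀ x ∈ Icc s t, f₂ x ≤ 0) (hx : x ∈ Icc s t) : f x ≤ f s + f₁ s * (x - s) := by
  rcases hx.1.eq_or_lt with rfl | hsx
  · simp
  have hs := left_mem_Icc.2 (hx.1.trans hx.2)
  have hslope := (concaveOn_Icc_of_deriv2_nonpos hf hf₁ hf₂).slope_le_of_hasDerivWithinAt
    hs hx hsx (hf s hs)
  rw [slope_def_field, div_le_iff₀ (sub_pos.2 hsx)] at hslope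
  linarith

lemma hasDerivAt_parabola (L x : ℝ) : HasDerivAt (fun t => t * (L - t) / 2) (L / 2 - x) x :=
  (((hasDerivAt_id' x).mul ((hasDerivAt_id' x).const_sub L)).div_const 2).congr_deriv (by ring)

lemma le_parabola_of_le_deriv2 {L B : ℝ}
    (hf : ∀ x ∈ Icc 0 L, HasDerivWithinAt f (f₁ x) (Icc 0 L) x)
    (hf₁ : ∀ x ∈ Icc 0 L, HasDerivWithinAt f₁ (f₂ x) (Icc 0 L) x)
    (hf₂ : ∀ x ∈ Icc 0 L, -B ≤ f₂ x) (h0 : f 0 ≤ 0) (hL : f L ≤ 0) (hx : x ∈ Icc 0 L) :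
    f x ≤ B * (x * (L - x) / 2) := by
  have hg : ∀ y ∈ Icc 0 L, HasDerivWithinAt (fun t => B * (t * (L - t) / 2) - f t)
      (B * (L / 2 - y) - f₁ y) (Icc 0 L) y := fun y hy =>
    ((hasDerivAt_parabola L y).const_mul B).hasDerivWithinAt.sub (hf y hy)
  have hg₁ : ∀ y ∈ Icc 0 L, HasDerivWithinAt (fun t => B * (L / 2 - t) - f₁ t)
      (B * -1 - f₂ y) (Icc 0 L) y := fun y hy =>
    (((hasDerivAt_id' y).const_sub _).const_mul B).hasDerivWithinAt.sub (hf₁ y hy)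
  have hgx := nonneg_of_deriv2_nonpos hg hg₁ (fun y hy => by linarith [hf₂ y hy])
    (by simpa using h0) (by simpa using hL) hx
  exact sub_nonneg.1 hgx

lemma abs_le_parabola_of_abs_deriv2_le {L B : ℝ}
    (hf : ∀ x ∈ Icc 0 L, HasDerivWithinAt f (f₁ x) (Icc 0 L) x)
    (hf₁ : ∀ x ∈ Icc 0 L, HasDerivWithinAt f₁ (f₂ x) (Icc 0 L) x)
    (hf₂ : ∀ x ∈ Icc 0 L, |f₂ x| ≤ B) (h0 : f 0 = 0) (hL : f L = 0) (hx : x ∈ Icc 0 L) :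
    |f x| ≤ B * (x * (L - x) / 2) :=
  abs_le'.2 ⟨le_parabola_of_le_deriv2 hf hf₁ (fun y hy => (abs_le.1 (hf₂ y hy)).1) h0.le hL.le hx,
    le_parabola_of_le_deriv2 (fun y hy => (hf y hy).neg) (fun y hy => (hf₁ y hy).neg)
      (fun y hy => neg_le_neg (abs_le.1 (hf₂ y hy)).2) (by simp [h0]) (by simp [hL]) hx⟩

lemma integral_deriv_mul_sub_mul_deriv2 {u u₁ ψ ψ₁ ψ₂ : ℝ → ℝ} (hst : s ≤ t)
    (hu : ∀ x ∈ Icc s t, HasDerivWithinAt u (u₁ x) (Icc s t) x)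
    (hu₁ : AbsolutelyContinuousOnInterval u₁ s t)
    (hψ : ∀ x, HasDerivAt ψ (ψ₁ x) x) (hψ₁ : ∀ x, HasDerivAt ψ₁ (ψ₂ x) x)
    (hψ₂ : Continuous ψ₂) :
    ∫ x in s..t, (deriv u₁ x * ψ x - u x * ψ₂ x)
      = (u₁ t * ψ t - u t * ψ₁ t) - (u₁ s * ψ s - u s * ψ₁ s) := by
  have continuous_ψ : Continuous ψ := continuous_iff_continuousAt.2 fun x => (hψ x).continuousAt
  have continuous_ψ₁ : Continuous ψ₁ :=
    continuous_iff_continuousAt.2 fun x => (hψ₁ x).continuousAt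
  have deriv_ψ : deriv ψ = ψ₁ := funext fun x => (hψ x).deriv
  have hψ_ac : AbsolutelyContinuousOnInterval ψ s t :=
    (contDiff_one_iff_deriv.2 ⟨fun x => (hψ x).differentiableAt,
      deriv_ψ ▸ continuous_ψ₁⟩).contDiffOn.absolutelyContinuousOnInterval
  rw [← uIcc_of_le hst] at hu
  have continuousOn_u : ContinuousOn u (uIcc s t) := fun x hx => (hu x hx).continuousWithinAt
  have first_parts := hψ_ac.integral_mul_deriv_eq_deriv_mul hu₁
  have second_parts := intervalIntegral.integral_mul_deriv_eq_deriv_mul_of_hasDerivWithinAt hu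
    (fun x _ => (hψ₁ x).hasDerivWithinAt) hu₁.continuousOn.intervalIntegrable
    (hψ₂.intervalIntegrable _ _)
  rw [intervalIntegral.integral_sub
    (hu₁.intervalIntegrable_deriv.mul_continuousOn continuous_ψ.continuousOn)
    (continuousOn_u.intervalIntegrable.mul_continuousOn hψ₂.continuousOn)]
  simp only [deriv_ψ, mul_comm (ψ _), mul_comm (ψ₁ _)] at first_parts
  linarith

end Calculus

/-! ### Responses of the Dirichlet problem `-u'' + m² u = f` -/

/-- The solution of `-e'' + m² e = 1`, `e(0) = e(L) = 0`. -/
noncomputable def unitResponse (m L x : ℝ) : ℝ :=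
  (1 - (sinh (m * (L - x)) + sinh (m * x)) / sinh (m * L)) / m ^ 2

/-- The derivative `e'` of `unitResponse m L`, in closed form. -/
noncomputable def unitResponseDeriv (m L x : ℝ) : ℝ :=
  (cosh (m * (L - x)) - cosh (m * x)) / (m * sinh (m * L))

/-- The solution of `-E'' + m² E = x (L - x) / 2`, `E(0) = E(L) = 0`. It satisfies
`E'''' - m² E'' = 1`, so that `∫ w = ∫ (w'''' - m² w'') E` under Navier conditions. -/
noncomputable def parabolaResponse (m L x : ℝ) : ℝ :=
  (x * (L - x) / 2 - unitResponse m L x) / m ^ 2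

/-- The derivative `E'` of `parabolaResponse m L`, in closed form. -/
noncomputable def parabolaResponseDeriv (m L x : ℝ) : ℝ :=
  (L / 2 - x - unitResponseDeriv m L x) / m ^ 2

section Responses

variable {m L x t : ℝ}

lemma sinh_mul_pos (hm : 0 < m) (hL : 0 < L) : 0 < sinh (m * L) :=
  Real.sinh_pos_iff.2 (mul_pos hm hL)

lemma hasDerivAt_sinh_mul (m x : ℝ) :
    HasDerivAt (fun t => sinh (m * t)) (m * cosh (m * x)) x := by
  simpa [mul_comm] using ((hasDerivAt_id x).const_mul m).sinh

lemma hasDerivAt_cosh_mul (m x : ℝ) :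
    HasDerivAt (fun t => cosh (m * t)) (m * sinh (m * x)) x := by
  simpa [mul_comm] using ((hasDerivAt_id x).const_mul m).cosh

lemma hasDerivAt_sinh_mul_sub (m L x : ℝ) :
    HasDerivAt (fun t => sinh (m * (L - t))) (-(m * cosh (m * (L - x)))) x := by
  simpa [mul_comm] using (((hasDerivAt_id x).const_sub L).const_mul m).sinh

lemma hasDerivAt_cosh_mul_sub (m L x : ℝ) :
    HasDerivAt (fun t => cosh (m * (L - t))) (-(m * sinh (m * (L - x)))) x := by
  simpa [mul_comm] using (((hasDerivAt_id x).const_sub L).const_mul m).cosh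

lemma hasDerivAt_unitResponse (hm : 0 < m) (hL : 0 < L) (x : ℝ) :
    HasDerivAt (unitResponse m L) (unitResponseDeriv m L x) x := by
  refine (((((hasDerivAt_sinh_mul_sub m L x).add (hasDerivAt_sinh_mul m x)).div_const
    (sinh (m * L))).const_sub 1).div_const (m ^ 2)).congr_deriv ?_
  rw [unitResponseDeriv]
  field [(sinh_mul_pos hm hL).ne']

lemma hasDerivAt_unitResponseDeriv (hm : 0 < m) (hL : 0 < L) (x : ℝ) :
    HasDerivAt (unitResponseDeriv m L) (m ^ 2 * unitResponse m L x - 1) x := by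
  refine (((hasDerivAt_cosh_mul_sub m L x).sub (hasDerivAt_cosh_mul m x)).div_const
    (m * sinh (m * L))).congr_deriv ?_
  rw [unitResponse]
  field [(sinh_mul_pos hm hL).ne']

lemma hasDerivAt_parabolaResponse (hm : 0 < m) (hL : 0 < L) (x : ℝ) :
    HasDerivAt (parabolaResponse m L) (parabolaResponseDeriv m L x) x :=
  ((hasDerivAt_parabola L x).sub (hasDerivAt_unitResponse hm hL x)).div_const _

lemma hasDerivAt_parabolaResponseDeriv (hm : 0 < m) (hL : 0 < L) (x : ℝ) :
    HasDerivAt (parabolaResponseDeriv m L) (-unitResponse m L x) x := by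
  refine ((((hasDerivAt_id' x).const_sub (L / 2)).sub
    (hasDerivAt_unitResponseDeriv hm hL x)).div_const _).congr_deriv ?_
  field

@[fun_prop]
lemma continuous_unitResponse (m L : ℝ) : Continuous (unitResponse m L) := by
  unfold unitResponse
  fun_prop

@[fun_prop]
lemma continuous_parabolaResponse (m L : ℝ) : Continuous (parabolaResponse m L) := by
  unfold parabolaResponse
  fun_prop

lemma unitResponse_sub (m L x : ℝ) : unitResponse m L (L - x) = unitResponse m L x := by
  simp [unitResponse, add_comm]

lemma parabolaResponse_sub (m L x : ℝ) :
    parabolaResponse m L (L - x) = parabolaResponse m L x := by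
  rw [parabolaResponse, unitResponse_sub, parabolaResponse]
  ring

lemma unitResponse_zero (hm : 0 < m) (hL : 0 < L) : unitResponse m L 0 = 0 := by
  simp [unitResponse, (sinh_mul_pos hm hL).ne']

lemma unitResponse_right (hm : 0 < m) (hL : 0 < L) : unitResponse m L L = 0 := by
  simpa [unitResponse_zero hm hL] using unitResponse_sub m L 0

lemma parabolaResponse_zero (hm : 0 < m) (hL : 0 < L) : parabolaResponse m L 0 = 0 := by
  simp [parabolaResponse, unitResponse_zero hm hL]

lemma parabolaResponse_right (hm : 0 < m) (hL : 0 < L) : parabolaResponse m L L = 0 := by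
  simpa [parabolaResponse_zero hm hL] using parabolaResponse_sub m L 0

lemma unitResponse_deriv2_nonpos (hm : 0 < m) (hL : 0 < L) (hx : x ∈ Icc 0 L) :
    m ^ 2 * unitResponse m L x - 1 ≤ 0 := by
  have left_nonneg : 0 ≤ sinh (m * (L - x)) :=
    Real.sinh_nonneg_iff.2 (mul_nonneg hm.le (sub_nonneg.2 hx.2))
  have right_nonneg : 0 ≤ sinh (m * x) := Real.sinh_nonneg_iff.2 (mul_nonneg hm.le hx.1)
  have : 0 ≤ (sinh (m * (L - x)) + sinh (m * x)) / sinh (m * L) :=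
    div_nonneg (add_nonneg left_nonneg right_nonneg) (sinh_mul_pos hm hL).le
  rw [unitResponse, mul_div_cancel₀ _ (pow_ne_zero 2 hm.ne')]
  linarith

lemma unitResponse_nonneg (hm : 0 < m) (hL : 0 < L) (hx : x ∈ Icc 0 L) :
    0 ≤ unitResponse m L x :=
  nonneg_of_deriv2_nonpos (fun y _ => (hasDerivAt_unitResponse hm hL y).hasDerivWithinAt)
    (fun y _ => (hasDerivAt_unitResponseDeriv hm hL y).hasDerivWithinAt)
    (fun _ hy => unitResponse_deriv2_nonpos hm hL hy)
    (unitResponse_zero hm hL).ge (unitResponse_right hm hL).ge hx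

lemma parabolaResponse_nonneg (hm : 0 < m) (hL : 0 < L) (hx : x ∈ Icc 0 L) :
    0 ≤ parabolaResponse m L x :=
  nonneg_of_deriv2_nonpos (fun y _ => (hasDerivAt_parabolaResponse hm hL y).hasDerivWithinAt)
    (fun y _ => (hasDerivAt_parabolaResponseDeriv hm hL y).hasDerivWithinAt)
    (fun _ hy => neg_nonpos.2 (unitResponse_nonneg hm hL hy))
    (parabolaResponse_zero hm hL).ge (parabolaResponse_right hm hL).ge hx

lemma unitResponse_le_tangent (hm : 0 < m) (hL : 0 < L) (hx : x ∈ Icc 0 L) :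
    unitResponse m L x ≤ unitResponseDeriv m L 0 * x := by
  simpa [unitResponse_zero hm hL] using le_tangent_of_deriv2_nonpos
    (fun y _ => (hasDerivAt_unitResponse hm hL y).hasDerivWithinAt)
    (fun y _ => (hasDerivAt_unitResponseDeriv hm hL y).hasDerivWithinAt)
    (fun _ hy => unitResponse_deriv2_nonpos hm hL hy) hx

lemma parabolaResponse_le_tangent (hm : 0 < m) (hL : 0 < L) (hx : x ∈ Icc 0 L) :
    parabolaResponse m L x ≤ parabolaResponseDeriv m L 0 * x := by
  simpa [parabolaResponse_zero hm hL] using le_tangent_of_deriv2_nonpos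
    (fun y _ => (hasDerivAt_parabolaResponse hm hL y).hasDerivWithinAt)
    (fun y _ => (hasDerivAt_parabolaResponseDeriv hm hL y).hasDerivWithinAt)
    (fun _ hy => neg_nonpos.2 (unitResponse_nonneg hm hL hy)) hx

lemma unitResponseDeriv_zero_nonneg (hm : 0 < m) (hL : 0 < L) : 0 ≤ unitResponseDeriv m L 0 := by
  have h := unitResponse_le_tangent hm hL (right_mem_Icc.2 hL.le)
  rw [unitResponse_right hm hL] at h
  exact nonneg_of_mul_nonneg_left h hL

lemma parabolaResponseDeriv_zero_nonneg (hm : 0 < m) (hL : 0 < L) :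
    0 ≤ parabolaResponseDeriv m L 0 := by
  have h := parabolaResponse_le_tangent hm hL (right_mem_Icc.2 hL.le)
  rw [parabolaResponse_right hm hL] at h
  exact nonneg_of_mul_nonneg_left h hL

lemma unitResponse_mul_parabolaResponse_le (hm : 0 < m) (hL : 0 < L) (hx : x ∈ Icc 0 L)
    (ht : t ∈ Icc 0 L) :
    unitResponse m L x * parabolaResponse m L t
      ≤ unitResponseDeriv m L 0 * parabolaResponseDeriv m L 0 / m ^ 2
        * (sinh (m * x) * sinh (m * t)) := by
  have he := unitResponseDeriv_zero_nonneg hm hL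
  have hE := parabolaResponseDeriv_zero_nonneg hm hL
  have hmx := mul_nonneg hm.le hx.1
  have hmt := mul_nonneg hm.le ht.1
  calc unitResponse m L x * parabolaResponse m L t
      ≤ (unitResponseDeriv m L 0 * x) * (parabolaResponseDeriv m L 0 * t) :=
        mul_le_mul (unitResponse_le_tangent hm hL hx) (parabolaResponse_le_tangent hm hL ht)
          (parabolaResponse_nonneg hm hL ht) (mul_nonneg he hx.1)
    _ = unitResponseDeriv m L 0 * parabolaResponseDeriv m L 0 / m ^ 2
        * ((m * x) * (m * t)) := by field
    _ ≤ unitResponseDeriv m L 0 * parabolaResponseDeriv m L 0 / m ^ 2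
        * (sinh (m * x) * sinh (m * t)) := by
      gcongr
      exacts [Real.self_le_sinh_iff.2 hmx, Real.self_le_sinh_iff.2 hmt]

lemma integral_parabolaResponse (hm : 0 < m) (hL : 0 < L) :
    ∫ t in (0 : ℝ)..L, parabolaResponse m L t
      = (L ^ 3 / 12 - (L - 2 * unitResponseDeriv m L 0) / m ^ 2) / m ^ 2 := by
  have h : ∀ x, HasDerivAt
      (fun x => (L * x ^ 2 / 4 - x ^ 3 / 6 - (x + unitResponseDeriv m L x) / m ^ 2) / m ^ 2)
      (parabolaResponse m L x) x := fun x => by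
    refine ((((((hasDerivAt_pow 2 x).const_mul L).div_const 4).sub
      ((hasDerivAt_pow 3 x).div_const 6)).sub (((hasDerivAt_id' x).add
        (hasDerivAt_unitResponseDeriv hm hL x)).div_const _)).div_const _).congr_deriv ?_
    rw [parabolaResponse]
    push_cast
    field
  rw [intervalIntegral.integral_eq_sub_of_hasDerivAt (fun x _ => h x)
    ((continuous_parabolaResponse m L).intervalIntegrable _ _)]
  have unitResponseDeriv_right : unitResponseDeriv m L L = -unitResponseDeriv m L 0 := by
    simp only [unitResponseDeriv, sub_self, sub_zero]
    ring
  rw [unitResponseDeriv_right]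
  ring

lemma integral_parabolaResponse_nonneg (hm : 0 < m) (hL : 0 < L) :
    0 ≤ ∫ t in (0 : ℝ)..L, parabolaResponse m L t :=
  intervalIntegral.integral_nonneg hL.le fun _ ht => parabolaResponse_nonneg hm hL ht

/-- The limit of `e(x) E(t) / g(x, t)` at the corners `(L, 0)` and `(0, L)`, where `e`, `E` and `g`
are `unitResponse m L`, `parabolaResponse m L` and `green m L`; it bounds this quotient. -/
noncomputable def cornerConst (m L : ℝ) : ℝ :=
  sinh (m * L) / m * (unitResponseDeriv m L 0 * parabolaResponseDeriv m L 0)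

lemma cornerConst_sub_integral_parabolaResponse (hm : 0 < m) (hL : 0 < L) :
    12 * m ^ 5 * (cornerConst m L - ∫ t in (0 : ℝ)..L, parabolaResponse m L t)
      = 6 * (m * L) * cosh (m * L) + 6 * (m * L) - 12 * sinh (m * L) - (m * L) ^ 3 := by
  have hs := (sinh_mul_pos hm hL).ne'
  have hc := Real.cosh_sq (m * L)
  simp only [integral_parabolaResponse hm hL, cornerConst, parabolaResponseDeriv,
    unitResponseDeriv, sub_zero, mul_zero, Real.cosh_zero]
  field_simp
  linear_combination (-24) * hc

lemma mul_cornerConst_le (hm : 0 < m) (hL : 0 < L) {N : ℝ} (hN : 0 ≤ N)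
    (h : N ≤ 4 * m ^ 2 / L ^ 3 * sigma (m * L)) :
    N * cornerConst m L ≤ 1 + N * ∫ t in (0 : ℝ)..L, parabolaResponse m L t := by
  suffices hgap : N * (12 * m ^ 5 *
      (cornerConst m L - ∫ t in (0 : ℝ)..L, parabolaResponse m L t)) ≤ 12 * m ^ 5 by
    have hm5 : 0 < 12 * m ^ 5 := by positivity
    rw [mul_left_comm] at hgap
    linarith [(mul_le_iff_le_one_right hm5).1 hgap]
  rw [cornerConst_sub_integral_parabolaResponse hm hL]
  rw [sigma] at h
  generalize 6 * (m * L) * cosh (m * L) + 6 * (m * L) - 12 * sinh (m * L) - (m * L) ^ 3 = d at *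
  rcases le_or_gt d 0 with hd | hd
  · exact (mul_nonpos_of_nonneg_of_nonpos hN hd).trans (by positivity)
  · rw [← le_div_iff₀ hd]
    refine h.trans_eq ?_
    field

end Responses

/-- The Green function of `-u'' + m² u` on `[0, L]` under Dirichlet conditions. -/
noncomputable def green (m L x t : ℝ) : ℝ :=
  sinh (m * min x t) * sinh (m * (L - max x t)) / (m * sinh (m * L))

/-- The kernel which recovers `-w''` from `w'''' - m² w'' + N ∫ w` under Navier conditions. -/
noncomputable def navierGreen (m N L x t : ℝ) : ℝ :=
  green m L x t - N / (1 + N * ∫ s in (0 : ℝ)..L, parabolaResponse m L s)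
    * (unitResponse m L x * parabolaResponse m L t)

section Green

variable {m N L x t : ℝ} {u u₁ w : ℝ → ℝ}

@[fun_prop]
lemma continuous_green (m L x : ℝ) : Continuous (green m L x) := by
  unfold green
  fun_prop

lemma continuous_uncurry_navierGreen (m N L : ℝ) :
    Continuous (Function.uncurry (navierGreen m N L)) := by
  simp only [Function.uncurry_def, navierGreen, green]
  fun_prop

lemma one_add_mul_integral_parabolaResponse_pos (hm : 0 < m) (hL : 0 < L) (hN : 0 ≤ N) :
    0 < 1 + N * ∫ t in (0 : ℝ)..L, parabolaResponse m L t :=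
  add_pos_of_pos_of_nonneg one_pos (mul_nonneg hN (integral_parabolaResponse_nonneg hm hL))

lemma integral_mul_green_split (hx : x ∈ Icc 0 L) {f : ℝ → ℝ}
    (hf : IntervalIntegrable f volume 0 L) :
    ∫ t in (0 : ℝ)..L, f t * green m L x t
      = (sinh (m * (L - x)) * (∫ t in (0 : ℝ)..x, f t * sinh (m * t))
        + sinh (m * x) * ∫ t in x..L, f t * sinh (m * (L - t))) / (m * sinh (m * L)) := by
  have hL := hx.1.trans hx.2
  have hfg := hf.mul_continuousOn (continuous_green m L x).continuousOn
  rw [← intervalIntegral.integral_add_adjacent_intervals (b := x)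
    (hfg.mono_set (by grind [uIcc_of_le])) (hfg.mono_set (by grind [uIcc_of_le])), add_div]
  simp_rw [mul_div_right_comm, ← intervalIntegral.integral_const_mul]
  congr 1 <;> refine intervalIntegral.integral_congr fun t ht => ?_
  · rw [uIcc_of_le hx.1] at ht
    simp only [green, min_eq_right ht.2, max_eq_left ht.2]
    ring
  · rw [uIcc_of_le hx.2] at ht
    simp only [green, min_eq_left ht.1, max_eq_right ht.1]
    ring

lemma eq_integral_mul_green (hm : 0 < m) (hL : 0 < L)
    (hu : ∀ x ∈ Icc 0 L, HasDerivWithinAt u (u₁ x) (Icc 0 L) x)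
    (hu₁ : AbsolutelyContinuousOnInterval u₁ 0 L) (hu0 : u 0 = 0) (huL : u L = 0)
    (hx : x ∈ Icc 0 L) :
    u x = ∫ t in (0 : ℝ)..L, (m ^ 2 * u t - deriv u₁ t) * green m L x t := by
  have left : ∫ t in (0 : ℝ)..x, (deriv u₁ t * sinh (m * t) - u t * (m * (m * sinh (m * t))))
      = u₁ x * sinh (m * x) - u x * (m * cosh (m * x)) := by
    have hsub : Icc 0 x ⊆ Icc 0 L := Icc_subset_Icc le_rfl hx.2
    simpa [hu0] using integral_deriv_mul_sub_mul_deriv2 hx.1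
      (fun y hy => (hu y (hsub hy)).mono hsub)
      (hu₁.mono (by rwa [uIcc_of_le hx.1, uIcc_of_le hL.le])) (hasDerivAt_sinh_mul m)
      (fun t => (hasDerivAt_cosh_mul m t).const_mul m) (by fun_prop)
  have right : ∫ t in x..L,
      (deriv u₁ t * sinh (m * (L - t)) - u t * -(m * -(m * sinh (m * (L - t)))))
      = -(u₁ x * sinh (m * (L - x)) - u x * -(m * cosh (m * (L - x)))) := by
    have hsub : Icc x L ⊆ Icc 0 L := Icc_subset_Icc hx.1 le_rfl
    simpa [huL] using integral_deriv_mul_sub_mul_deriv2 hx.2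
      (fun y hy => (hu y (hsub hy)).mono hsub)
      (hu₁.mono (by rwa [uIcc_of_le hx.2, uIcc_of_le hL.le])) (hasDerivAt_sinh_mul_sub m L)
      (fun t => ((hasDerivAt_cosh_mul_sub m L t).const_mul m).neg) (by fun_prop)
  have integrable : IntervalIntegrable (fun t => m ^ 2 * u t - deriv u₁ t) volume 0 L :=
    ((ContinuousOn.intervalIntegrable_of_Icc hL.le fun y hy =>
      (hu y hy).continuousWithinAt).const_mul _).sub hu₁.intervalIntegrable_deriv
  have sinh_add : sinh (m * L)
      = sinh (m * (L - x)) * cosh (m * x) + cosh (m * (L - x)) * sinh (m * x) := by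
    rw [← Real.sinh_add]
    ring_nf
  have left' : ∫ t in (0 : ℝ)..x, (m ^ 2 * u t - deriv u₁ t) * sinh (m * t)
      = -(u₁ x * sinh (m * x) - u x * (m * cosh (m * x))) := by
    rw [← left, ← intervalIntegral.integral_neg]
    exact intervalIntegral.integral_congr fun t _ => by ring
  have right' : ∫ t in x..L, (m ^ 2 * u t - deriv u₁ t) * sinh (m * (L - t))
      = u₁ x * sinh (m * (L - x)) - u x * -(m * cosh (m * (L - x))) := by
    rw [← neg_eq_iff_eq_neg.2 right, ← intervalIntegral.integral_neg]
    exact intervalIntegral.integral_congr fun t _ => by ring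
  rw [integral_mul_green_split hx integrable, left', right',
    eq_div_iff (mul_pos hm (sinh_mul_pos hm hL)).ne', sinh_add]
  ring

lemma integral_green (hm : 0 < m) (hL : 0 < L) (hx : x ∈ Icc 0 L) :
    ∫ t in (0 : ℝ)..L, green m L x t = unitResponse m L x := by
  have deriv_eq (t : ℝ) := (hasDerivAt_unitResponseDeriv hm hL t).deriv
  have hac : AbsolutelyContinuousOnInterval (unitResponseDeriv m L) 0 L := by
    refine (contDiff_one_iff_deriv.2 ⟨fun t =>
      (hasDerivAt_unitResponseDeriv hm hL t).differentiableAt,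
      ?_⟩).contDiffOn.absolutelyContinuousOnInterval
    rw [funext deriv_eq]
    fun_prop
  have h := eq_integral_mul_green hm hL
    (fun y _ => (hasDerivAt_unitResponse hm hL y).hasDerivWithinAt) hac
    (unitResponse_zero hm hL) (unitResponse_right hm hL) hx
  simpa [deriv_eq] using h.symm

lemma unitResponse_mul_parabolaResponse_le_green (hm : 0 < m) (hL : 0 < L) (hx : x ∈ Icc 0 L)
    (ht : t ∈ Icc 0 L) :
    unitResponse m L x * parabolaResponse m L t ≤ cornerConst m L * green m L x t := by
  have hs := (sinh_mul_pos hm hL).ne'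
  have reflect {y : ℝ} (hy : y ∈ Icc 0 L) : L - y ∈ Icc 0 L :=
    ⟨sub_nonneg.2 hy.2, sub_le_self _ hy.1⟩
  rcases le_total t x with htx | hxt
  · rw [← unitResponse_sub]
    refine (unitResponse_mul_parabolaResponse_le hm hL (reflect hx) ht).trans_eq ?_
    rw [cornerConst, green, min_eq_right htx, max_eq_left htx]
    field
  · rw [← parabolaResponse_sub]
    refine (unitResponse_mul_parabolaResponse_le hm hL hx (reflect ht)).trans_eq ?_
    rw [cornerConst, green, min_eq_left hxt, max_eq_right hxt]
    field

lemma green_nonneg (hm : 0 < m) (hL : 0 < L) (hx : x ∈ Icc 0 L) (ht : t ∈ Icc 0 L) :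
    0 ≤ green m L x t :=
  div_nonneg (mul_nonneg
    (Real.sinh_nonneg_iff.2 (mul_nonneg hm.le (le_min hx.1 ht.1)))
    (Real.sinh_nonneg_iff.2 (mul_nonneg hm.le (sub_nonneg.2 (max_le hx.2 ht.2)))))
    (mul_pos hm (sinh_mul_pos hm hL)).le

lemma navierGreen_nonneg (hm : 0 < m) (hL : 0 < L) (hN : 0 ≤ N)
    (hσ : N ≤ 4 * m ^ 2 / L ^ 3 * sigma (m * L)) (hx : x ∈ Icc 0 L) (ht : t ∈ Icc 0 L) :
    0 ≤ navierGreen m N L x t := by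
  have hpos := one_add_mul_integral_parabolaResponse_pos hm hL hN
  rw [navierGreen, sub_nonneg, div_mul_eq_mul_div, div_le_iff₀ hpos]
  calc N * (unitResponse m L x * parabolaResponse m L t)
      ≤ N * (cornerConst m L * green m L x t) := by
        exact mul_le_mul_of_nonneg_left
          (unitResponse_mul_parabolaResponse_le_green hm hL hx ht) hN
    _ = N * cornerConst m L * green m L x t := by ring
    _ ≤ (1 + N * ∫ s in (0 : ℝ)..L, parabolaResponse m L s) * green m L x t := by
        gcongr
        exacts [green_nonneg hm hL hx ht, mul_cornerConst_le hm hL hN hσ]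
    _ = _ := mul_comm _ _

lemma integral_D_two_mul_parabola (hL : 0 < L) (hw : MemW41 L w) (hbc : NavierBC L w) :
    ∫ x in (0 : ℝ)..L, D L 2 w x * (x * (L - x) / 2) = -∫ x in (0 : ℝ)..L, w x := by
  have hac : AbsolutelyContinuousOnInterval (D L 1 w) 0 L := by
    refine ContDiffOn.absolutelyContinuousOnInterval ?_
    rw [uIcc_of_le hL.le]
    exact contDiffOn_succ_of_hasDerivWithinAt (n := 0) (uniqueDiffOn_Icc hL)
      (fun x hx => hw.hasDerivWithinAt hL (by norm_num) hx)
      (contDiffOn_zero.2 (hw.continuousOn_D hL (by norm_num)))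
  have identity := integral_deriv_mul_sub_mul_deriv2 hL.le
    (fun x hx => hw.hasDerivWithinAt_self hL hx) hac (hasDerivAt_parabola L)
    (fun x => (hasDerivAt_id' x).const_sub (L / 2)) continuous_const
  have integrable : IntervalIntegrable (fun x => D L 2 w x * (x * (L - x) / 2)) volume 0 L :=
    (hw.intervalIntegrable_D hL (by norm_num)).mul_continuousOn (by fun_prop)
  rw [← add_eq_zero_iff_eq_neg, ← intervalIntegral.integral_add integrable
    (hw.intervalIntegrable hL)]
  simp only [hbc.1, hbc.2.1, mul_zero, zero_mul, zero_div, sub_self] at identity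
  refine (integral_congr_ae_Ioo hL.le ?_).trans identity
  filter_upwards [ae_restrict_mem measurableSet_Ioo] with x hx
  rw [D_succ_eq_deriv 1 w hx]
  ring

lemma integral_eq_integral_mul_parabolaResponse (hm : 0 < m) (hL : 0 < L) (hw : MemW41 L w)
    (hbc : NavierBC L w) :
    ∫ x in (0 : ℝ)..L, w x
      = ∫ x in (0 : ℝ)..L, (D L 4 w x - m ^ 2 * D L 2 w x) * parabolaResponse m L x := by
  have identity := integral_deriv_mul_sub_mul_deriv2 hL.le
    (fun x hx => hw.hasDerivWithinAt hL (k := 2) (by norm_num) hx) hw.2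
    (hasDerivAt_parabolaResponse hm hL) (hasDerivAt_parabolaResponseDeriv hm hL) (by fun_prop)
  have integrable_left : IntervalIntegrable (fun x => deriv (D L 3 w) x * parabolaResponse m L x
      - D L 2 w x * -unitResponse m L x) volume 0 L :=
    (hw.2.intervalIntegrable_deriv.mul_continuousOn (by fun_prop)).sub
      ((hw.intervalIntegrable_D hL (by norm_num)).mul_continuousOn (by fun_prop))
  have integrable_right : IntervalIntegrable (fun x => D L 2 w x * (x * (L - x) / 2)) volume 0 L :=
    (hw.intervalIntegrable_D hL (by norm_num)).mul_continuousOn (by fun_prop)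
  rw [parabolaResponse_zero hm hL, parabolaResponse_right hm hL, hbc.2.2.1, hbc.2.2.2] at identity
  simp only [mul_zero, zero_mul, sub_self] at identity
  rw [← neg_neg (∫ x in (0 : ℝ)..L, w x), ← integral_D_two_mul_parabola hL hw hbc, ← zero_sub]
  refine (congrArg (· - _) identity).symm.trans ?_
  refine (intervalIntegral.integral_sub integrable_left integrable_right).symm.trans ?_
  refine integral_congr_ae_Ioo hL.le ?_
  filter_upwards [ae_restrict_mem measurableSet_Ioo] with x hx
  rw [D_succ_eq_deriv 3 w hx, parabolaResponse]
  field

lemma integral_eq_integral_linOp (hm : 0 < m) (hL : 0 < L) (hN : 0 ≤ N) (hw : MemW41 L w)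
    (hbc : NavierBC L w) :
    ∫ x in (0 : ℝ)..L, w x
      = (∫ x in (0 : ℝ)..L, linOp (m ^ 2) N L w x * parabolaResponse m L x)
        / (1 + N * ∫ x in (0 : ℝ)..L, parabolaResponse m L x) := by
  rw [eq_div_iff (one_add_mul_integral_parabolaResponse_pos hm hL hN).ne', mul_add, mul_one]
  nth_rw 1 [integral_eq_integral_mul_parabolaResponse hm hL hw hbc]
  rw [← mul_assoc, ← intervalIntegral.integral_const_mul, ← intervalIntegral.integral_add
    (((hw.intervalIntegrable_D_four hL).sub
      ((hw.intervalIntegrable_D hL (by norm_num)).const_mul _)).mul_continuousOn (by fun_prop))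
    (Continuous.intervalIntegrable (by fun_prop) _ _)]
  refine intervalIntegral.integral_congr fun x _ => ?_
  simp only [linOp]
  ring

lemma neg_D_two_eq_integral_navierGreen (hm : 0 < m) (hL : 0 < L) (hN : 0 ≤ N)
    (hw : MemW41 L w) (hbc : NavierBC L w) (hx : x ∈ Icc 0 L) :
    -D L 2 w x = ∫ t in (0 : ℝ)..L, linOp (m ^ 2) N L w t * navierGreen m N L x t := by
  have dirichlet : -D L 2 w x = ∫ t in (0 : ℝ)..L,
      (linOp (m ^ 2) N L w t * green m L x t
        - N * (∫ t in (0 : ℝ)..L, w t) * green m L x t) := by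
    rw [eq_integral_mul_green hm hL (fun y hy => hw.hasDerivWithinAt hL (by norm_num) hy) hw.2
      hbc.2.2.1 hbc.2.2.2 hx, ← intervalIntegral.integral_neg]
    refine integral_congr_ae_Ioo hL.le ?_
    filter_upwards [ae_restrict_mem measurableSet_Ioo] with t ht
    rw [linOp, D_succ_eq_deriv 3 w ht]
    ring
  have hlin := intervalIntegrable_linOp (m ^ 2) N hL hw
  simp only [navierGreen, mul_sub, mul_left_comm (linOp _ _ _ _ _)]
  rw [dirichlet, intervalIntegral.integral_sub (hlin.mul_continuousOn (by fun_prop))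
      (Continuous.intervalIntegrable (by fun_prop) _ _),
    intervalIntegral.integral_sub (hlin.mul_continuousOn (by fun_prop))
      (((hlin.mul_continuousOn (by fun_prop)).const_mul _).const_mul _),
    intervalIntegral.integral_const_mul, integral_green hm hL hx,
    intervalIntegral.integral_const_mul, intervalIntegral.integral_const_mul,
    integral_eq_integral_linOp hm hL hN hw hbc]
  ring

end Green

/-! ### The maximum principle for `G` -/

section MaximumPrinciple

variable {M N L x : ℝ} {u v w : ℝ → ℝ}

lemma nonneg_of_D_two_nonpos (hL : 0 < L) (hw : MemW41 L w) (hbc : NavierBC L w)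
    (h : ∀ x ∈ Icc 0 L, D L 2 w x ≤ 0) (hx : x ∈ Icc 0 L) : 0 ≤ w x :=
  nonneg_of_deriv2_nonpos (fun _ hy => hw.hasDerivWithinAt_self hL hy)
    (fun _ hy => hw.hasDerivWithinAt hL (by norm_num) hy) h hbc.1.ge hbc.2.1.ge hx

lemma D_two_nonpos_of_linOp_nonneg (hL : 0 < L) (hM : 0 < M) (hN : 0 ≤ N)
    (hσ : N ≤ 4 * M / L ^ 3 * sigma (√M * L)) (hw : MemW41 L w) (hbc : NavierBC L w)
    (h : ∀ᵐ x ∂volume.restrict (Ioo 0 L), 0 ≤ linOp M N L w x) (hx : x ∈ Icc 0 L) :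
    D L 2 w x ≤ 0 := by
  have hm := Real.sqrt_pos.2 hM
  rw [← Real.sq_sqrt hM.le] at h
  rw [← neg_nonneg, neg_D_two_eq_integral_navierGreen hm hL hN hw hbc hx]
  refine intervalIntegral.integral_nonneg_of_ae_restrict hL.le ?_
  rw [← Measure.restrict_congr_set Ioo_ae_eq_Icc]
  filter_upwards [h, ae_restrict_mem measurableSet_Ioo] with t ht ht'
  exact mul_nonneg ht (navierGreen_nonneg hm hL hN (by rwa [Real.sq_sqrt hM.le]) hx
    (Ioo_subset_Icc_self ht'))

theorem below_of_linOp_le (hL : 0 < L) (hM : 0 < M) (hN : 0 ≤ N)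
    (hσ : N ≤ 4 * M / L ^ 3 * sigma (√M * L)) (hu : MemW41 L u) (hv : MemW41 L v)
    (hbu : NavierBC L u) (hbv : NavierBC L v)
    (h : ∀ᵐ x ∂volume.restrict (Ioo 0 L), linOp M N L u x ≤ linOp M N L v x) : Below L u v := by
  have hw := hv.sub hL hu
  have hbw := hbv.sub hL hv hu hbu
  have D_two_nonpos : ∀ x ∈ Icc 0 L, D L 2 (v - u) x ≤ 0 := fun x hx => by
    refine D_two_nonpos_of_linOp_nonneg hL hM hN hσ hw hbw ?_ hx
    filter_upwards [linOp_sub hL hv hu, h] with t ht htuv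
    rw [ht]
    exact sub_nonneg.2 htuv
  refine fun x hx => ⟨?_, ?_⟩
  · have nonneg := nonneg_of_D_two_nonpos hL hw hbw D_two_nonpos hx
    exact sub_nonneg.1 nonneg
  · rw [← sub_nonpos, ← hv.D_sub hL hu (by norm_num) hx]
    exact D_two_nonpos x hx

theorem exists_abs_D_two_le_integral_abs_linOp (hL : 0 < L) (hM : 0 < M) (hN : 0 ≤ N) :
    ∃ B, ∀ w, MemW41 L w → NavierBC L w → ∀ x ∈ Icc 0 L,
      |D L 2 w x| ≤ B * ∫ t in (0 : ℝ)..L, |linOp M N L w t| := by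
  obtain ⟨B, hB⟩ := (isCompact_Icc.prod isCompact_Icc).exists_bound_of_continuousOn
    (continuous_uncurry_navierGreen √M N L).continuousOn (s := Icc 0 L ×ˢ Icc 0 L)
  refine ⟨B, fun w hw hbc x hx => ?_⟩
  rw [← abs_neg, neg_D_two_eq_integral_navierGreen (Real.sqrt_pos.2 hM) hL hN hw hbc hx,
    Real.sq_sqrt hM.le, ← intervalIntegral.integral_const_mul, ← Real.norm_eq_abs]
  refine intervalIntegral.norm_integral_le_of_norm_le hL.le (ae_of_all _ fun t ht => ?_)
    ((intervalIntegrable_linOp M N hL hw).abs.const_mul B)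
  rw [norm_mul, mul_comm, Real.norm_eq_abs (linOp _ _ _ _ _)]
  exact mul_le_mul_of_nonneg_right (hB (x, t) ⟨hx, Ioc_subset_Icc_self ht⟩) (abs_nonneg _)

lemma abs_le_of_abs_D_two_le {B : ℝ} (hL : 0 < L) (hw : MemW41 L w) (hbc : NavierBC L w)
    (h : ∀ x ∈ Icc 0 L, |D L 2 w x| ≤ B) (hx : x ∈ Icc 0 L) : |w x| ≤ L ^ 2 / 8 * B := by
  refine (abs_le_parabola_of_abs_deriv2_le (fun _ hy => hw.hasDerivWithinAt_self hL hy)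
    (fun _ hy => hw.hasDerivWithinAt hL (by norm_num) hy) h hbc.1 hbc.2.1 hx).trans ?_
  rw [mul_comm]
  exact mul_le_mul_of_nonneg_right (by linarith [sq_nonneg (L - 2 * x)])
    ((abs_nonneg _).trans (h x hx))

end MaximumPrinciple

section Existence

variable {m M N L : ℝ} {f h : ℝ → ℝ}

lemma exists_forced_solution (m : ℝ) {Q : ℝ → ℝ} (hQ : Continuous Q) :
    ∃ s s₁ : ℝ → ℝ, (∀ x, HasDerivAt s (s₁ x) x) ∧
      (∀ x, HasDerivAt s₁ (m ^ 2 * (s x - Q x)) x) ∧ s 0 = 0 := by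
  let C (x : ℝ) := ∫ t in (0 : ℝ)..x, cosh (m * t) * Q t
  let S (x : ℝ) := ∫ t in (0 : ℝ)..x, sinh (m * t) * Q t
  have hC (x : ℝ) : HasDerivAt C (cosh (m * x) * Q x) x :=
    (Continuous.integral_hasStrictDerivAt (by fun_prop) 0 x).hasDerivAt
  have hS (x : ℝ) : HasDerivAt S (sinh (m * x) * Q x) x :=
    (Continuous.integral_hasStrictDerivAt (by fun_prop) 0 x).hasDerivAt
  refine ⟨fun x => -m * (sinh (m * x) * C x - cosh (m * x) * S x),
    fun x => -m ^ 2 * (cosh (m * x) * C x - sinh (m * x) * S x), fun x => ?_, fun x => ?_,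
    by simp [S]⟩
  · refine ((((hasDerivAt_sinh_mul m x).mul (hC x)).sub
      ((hasDerivAt_cosh_mul m x).mul (hS x))).const_mul (-m)).congr_deriv ?_
    ring
  · refine ((((hasDerivAt_cosh_mul m x).mul (hC x)).sub
      ((hasDerivAt_sinh_mul m x).mul (hS x))).const_mul (-m ^ 2)).congr_deriv ?_
    linear_combination (-m ^ 2 * Q x) * Real.cosh_sq (m * x)

-- The second primitive `Q` of `f` is subtracted so that only a continuous force remains.
lemma exists_dirichlet_solution (hm : 0 < m) (hL : 0 < L) (hf : Integrable f) :
    ∃ v v₁ : ℝ → ℝ, (∀ x, HasDerivAt v (v₁ x) x) ∧ AbsolutelyContinuousOnInterval v₁ 0 L ∧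
      (∀ᵐ x ∂volume.restrict (Ioo 0 L), HasDerivAt v₁ (m ^ 2 * v x - f x) x) ∧
      v 0 = 0 ∧ v L = 0 := by
  have hf' : IntervalIntegrable f volume 0 L := hf.intervalIntegrable
  let P (x : ℝ) := ∫ t in (0 : ℝ)..x, f t
  let Q (x : ℝ) := ∫ t in (0 : ℝ)..x, P t
  have hP : ∀ᵐ x ∂volume.restrict (Ioo 0 L), HasDerivAt P (f x) x := by
    filter_upwards [ae_restrict_of_ae hf'.ae_hasDerivAt_integral,
      ae_restrict_mem measurableSet_Ioo] with x hx hx'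
    exact hx (by rw [uIcc_of_le hL.le]; exact Ioo_subset_Icc_self hx') 0 left_mem_uIcc
  have hQ (x : ℝ) : HasDerivAt Q (P x) x :=
    ((intervalIntegral.continuous_primitive (fun _ _ => hf.intervalIntegrable)
      0).integral_hasStrictDerivAt 0 x).hasDerivAt
  obtain ⟨s, s₁, hs, hs₁, hs0⟩ := exists_forced_solution m
    (continuous_iff_continuousAt.2 fun x => (hQ x).continuousAt)
  let k := (Q L - s L) / sinh (m * L)
  let v (x : ℝ) := s x - Q x + k * sinh (m * x)
  let r (x : ℝ) := s₁ x + k * (m * cosh (m * x))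
  have hv (x : ℝ) : HasDerivAt v (r x - P x) x :=
    (((hs x).sub (hQ x)).add ((hasDerivAt_sinh_mul m x).const_mul k)).congr_deriv
      (sub_add_eq_add_sub _ _ _)
  have hr (x : ℝ) : HasDerivAt r (m ^ 2 * v x) x :=
    ((hs₁ x).add (((hasDerivAt_cosh_mul m x).const_mul m).const_mul k)).congr_deriv (by
      simp only [v]; ring)
  have r_contDiff : ContDiff ℝ 1 r := contDiff_one_iff_deriv.2 ⟨fun x => (hr x).differentiableAt, by
    rw [funext fun x => (hr x).deriv]
    exact (continuous_iff_continuousAt.2 fun x => (hv x).continuousAt).const_mul _⟩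
  refine ⟨v, fun x => r x - P x, hv, r_contDiff.contDiffOn.absolutelyContinuousOnInterval.sub
    (hf'.absolutelyContinuousOnInterval_intervalIntegral left_mem_uIcc),
    hP.mono fun x hx => (hr x).sub hx, by simp [v, Q, hs0], ?_⟩
  have := (sinh_mul_pos hm hL).ne'
  simp only [v, k]
  field

lemma exists_primitive_with_zeros (hL : 0 < L) {v : ℝ → ℝ} (hv : Continuous v) :
    ∃ w w₁ : ℝ → ℝ, (∀ x, HasDerivAt w (w₁ x) x) ∧ (∀ x, HasDerivAt w₁ (v x) x) ∧
      w 0 = 0 ∧ w L = 0 := by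
  let V (x : ℝ) := ∫ t in (0 : ℝ)..x, v t
  let W (x : ℝ) := ∫ t in (0 : ℝ)..x, V t
  have hV (x : ℝ) : HasDerivAt V (v x) x := (hv.integral_hasStrictDerivAt 0 x).hasDerivAt
  have hW (x : ℝ) : HasDerivAt W (V x) x :=
    ((continuous_iff_continuousAt.2 fun x => (hV x).continuousAt).integral_hasStrictDerivAt
      0 x).hasDerivAt
  refine ⟨fun x => W x - W L / L * x, fun x => V x - W L / L, fun x => ?_,
    fun x => (hV x).sub_const _, by simp [W], by field⟩
  exact ((hW x).sub ((hasDerivAt_id' x).const_mul _)).congr_deriv (by rw [mul_one])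

lemma exists_navier_solution (hm : 0 < m) (hL : 0 < L) (hf : IntervalIntegrable f volume 0 L) :
    ∃ w, MemW41 L w ∧ NavierBC L w ∧
      ∀ᵐ x ∂volume.restrict (Ioo 0 L), D L 4 w x - m ^ 2 * D L 2 w x = f x := by
  have hf' : Integrable ((Ioc 0 L).indicator f) :=
    (integrable_indicator_iff measurableSet_Ioc).2
      ((intervalIntegrable_iff_integrableOn_Ioc_of_le hL.le).1 hf)
  obtain ⟨v, v₁, hv, hv₁, hvf, hv0, hvL⟩ := exists_dirichlet_solution hm hL hf'
  obtain ⟨w, w₁, hw, hw₁, hw0, hwL⟩ := exists_primitive_with_zeros hL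
    (continuous_iff_continuousAt.2 fun x => (hv x).continuousAt).neg
  have hw' : ∀ x ∈ Icc 0 L, HasDerivWithinAt w (w₁ x) (Icc 0 L) x :=
    fun x _ => (hw x).hasDerivWithinAt
  have hw₁' : ∀ x ∈ Icc 0 L, HasDerivWithinAt w₁ (-v x) (Icc 0 L) x :=
    fun x _ => (hw₁ x).hasDerivWithinAt
  have hw₂ : ∀ x ∈ Icc 0 L, HasDerivWithinAt (fun x => -v x) (-v₁ x) (Icc 0 L) x :=
    fun x _ => (hv x).neg.hasDerivWithinAt
  have hD2 := eqOn_D_two hL hw' hw₁'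
  refine ⟨w, memW41_of_hasDerivWithinAt hL hw' hw₁' hw₂ hv₁.neg, ⟨hw0, hwL, ?_, ?_⟩, ?_⟩
  · exact (hD2 (left_mem_Icc.2 hL.le)).trans (neg_eq_zero.2 hv0)
  · exact (hD2 (right_mem_Icc.2 hL.le)).trans (neg_eq_zero.2 hvL)
  · filter_upwards [hvf, ae_restrict_mem measurableSet_Ioo] with x hvx hx
    rw [D_succ_eq_deriv 3 w hx, ((eqOn_D_three hL hw' hw₁' hw₂).eventuallyEq_of_mem
      (Icc_mem_nhds hx.1 hx.2)).deriv_eq, hvx.fun_neg.deriv, hD2 (Ioo_subset_Icc_self hx),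
      indicator_of_mem (Ioo_subset_Ioc_self hx)]
    ring

theorem exists_linOp_eq (hL : 0 < L) (hM : 0 < M) (hN : 0 ≤ N)
    (hh : IntervalIntegrable h volume 0 L) :
    ∃ w, MemW41 L w ∧ NavierBC L w ∧
      ∀ᵐ x ∂volume.restrict (Ioo 0 L), linOp M N L w x = h x := by
  obtain ⟨m, hm, rfl⟩ : ∃ m, 0 < m ∧ M = m ^ 2 :=
    ⟨√M, Real.sqrt_pos.2 hM, (Real.sq_sqrt hM.le).symm⟩
  have hpos := (one_add_mul_integral_parabolaResponse_pos hm hL hN).ne'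
  let K := (∫ t in (0 : ℝ)..L, h t * parabolaResponse m L t)
    / (1 + N * ∫ t in (0 : ℝ)..L, parabolaResponse m L t)
  obtain ⟨w, hw, hbc, hwh⟩ := exists_navier_solution hm hL
    (hh.sub (intervalIntegrable_const (c := N * K)))
  have integral_w : ∫ t in (0 : ℝ)..L, w t = K := by
    calc ∫ t in (0 : ℝ)..L, w t
        = ∫ t in (0 : ℝ)..L, (h t * parabolaResponse m L t - N * K * parabolaResponse m L t) := by
          rw [integral_eq_integral_mul_parabolaResponse hm hL hw hbc]
          refine integral_congr_ae_Ioo hL.le (hwh.mono fun x hx => ?_)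
          rw [hx, sub_mul]
      _ = (∫ t in (0 : ℝ)..L, h t * parabolaResponse m L t)
          - N * K * ∫ t in (0 : ℝ)..L, parabolaResponse m L t := by
          rw [intervalIntegral.integral_sub (hh.mul_continuousOn (by fun_prop))
            (Continuous.intervalIntegrable (by fun_prop) _ _), intervalIntegral.integral_const_mul]
      _ = K := by
          simp only [K]
          field
  refine ⟨w, hw, hbc, hwh.mono fun x hx => ?_⟩
  rw [linOp, hx, integral_w]
  ring

end Existence

/-! ### Monotone iteration -/

section Below

variable {L : ℝ} {u v w : ℝ → ℝ}

instance : Std.Refl (Below L) := ⟨fun _ _ _ => ⟨le_rfl, le_rfl⟩⟩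

instance : IsTrans (ℝ → ℝ) (Below L) :=
  ⟨fun _ _ _ h h' x hx => ⟨(h x hx).1.trans (h' x hx).1, (h' x hx).2.trans (h x hx).2⟩⟩

lemma Below.trans (h : Below L u v) (h' : Below L v w) : Below L u w := trans_of (Below L) h h'

lemma Below.eqOn (h : Below L u v) (h' : Below L v u) : EqOn u v (Icc 0 L) :=
  fun x hx => le_antisymm (h x hx).1 (h' x hx).1

lemma Below.integral_le (h : Below L u v) (hL : 0 < L) (hu : MemW41 L u) (hv : MemW41 L v) :
    ∫ t in (0 : ℝ)..L, u t ≤ ∫ t in (0 : ℝ)..L, v t :=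
  intervalIntegral.integral_mono_on hL.le (hu.intervalIntegrable hL) (hv.intervalIntegrable hL)
    fun x hx => (h x hx).1

end Below

/-- The right-hand side of one step of the iterative procedure, as a function of the integral
`κ` and of the second derivative `v` of the previous iterate. -/
def stepSource (a b c M N κ : ℝ) (p v : ℝ → ℝ) (x : ℝ) : ℝ :=
  p x + (a - M + b * κ) * v x + (N - c) * κ

section Step

variable {a b c L M N κ : ℝ} {p v y z : ℝ → ℝ}

lemma isStep_iff : IsStep a b c L M N p y z ↔ MemW41 L z ∧ NavierBC L z ∧
    ∀ᵐ x ∂volume.restrict (Ioo 0 L),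
      linOp M N L z x = stepSource a b c M N (∫ t in (0 : ℝ)..L, y t) p (D L 2 y) x := by
  have source_eq (x : ℝ) : rhs a b c L p y x - M * D L 2 y x + N * ∫ t in (0 : ℝ)..L, y t
      = stepSource a b c M N (∫ t in (0 : ℝ)..L, y t) p (D L 2 y) x := by
    simp only [rhs, stepSource]
    ring
  simp only [IsStep, source_eq]

lemma linOp_sub_stepSource (a b c L M N : ℝ) (p y : ℝ → ℝ) (x : ℝ) :
    linOp M N L y x - stepSource a b c M N (∫ t in (0 : ℝ)..L, y t) p (D L 2 y) x
      = melanOp a b c L y x - p x := by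
  simp only [linOp, melanOp, stepSource]
  ring

lemma isStep_self_iff : IsStep a b c L M N p y y ↔ IsSolution a b c L p y := by
  simp only [isStep_iff, IsSolution, ← sub_eq_zero (a := linOp _ _ _ _ _), linOp_sub_stepSource,
    sub_eq_zero]

lemma intervalIntegrable_stepSource (hL : 0 < L) (hp : IntegrableOn p (Icc 0 L))
    (hv : IntervalIntegrable v volume 0 L) :
    IntervalIntegrable (stepSource a b c M N κ p v) volume 0 L :=
  (((intervalIntegrable_iff_integrableOn_Icc_of_le hL.le).2 hp).add (hv.const_mul _)).add
    intervalIntegrable_const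

lemma exists_isStep (hL : 0 < L) (hM : 0 < M) (hN : 0 ≤ N) (hp : IntegrableOn p (Icc 0 L))
    (hy : MemW41 L y) : ∃ z, IsStep a b c L M N p y z := by
  simp only [isStep_iff]
  exact exists_linOp_eq hL hM hN
    (intervalIntegrable_stepSource hL hp (hy.intervalIntegrable_D hL (by norm_num)))

end Step

/-- Parameters for which `linOp M N L` satisfies the maximum principle under Navier conditions. -/
structure Admissible (L M N : ℝ) : Prop where
  L_pos : 0 < L
  M_pos : 0 < M
  N_nonneg : 0 ≤ N
  N_le : N ≤ 4 * M / L ^ 3 * sigma (√M * L)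

namespace Admissible

variable {a b c L M N : ℝ} {p α β y z y' z' y₀ : ℝ → ℝ} (S : Admissible L M N)

include S

lemma below_of_linOp_le (hy : MemW41 L y) (hz : MemW41 L z) (hby : NavierBC L y)
    (hbz : NavierBC L z)
    (h : ∀ᵐ x ∂volume.restrict (Ioo 0 L), linOp M N L y x ≤ linOp M N L z x) : Below L y z :=
  Melan.below_of_linOp_le S.L_pos S.M_pos S.N_nonneg S.N_le hy hz hby hbz h

lemma eqOn_of_isStep (h : EqOn y y' (Icc 0 L)) (hz : IsStep a b c L M N p y z)
    (hz' : IsStep a b c L M N p y' z') : EqOn z z' (Icc 0 L) := by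
  have linOp_eq : ∀ᵐ x ∂volume.restrict (Ioo 0 L), linOp M N L z x = linOp M N L z' x := by
    filter_upwards [hz.2.2, hz'.2.2, ae_restrict_mem measurableSet_Ioo] with x hzx hzx' hx
    rw [hzx, hzx', rhs, rhs, D_congr 2 h (Ioo_subset_Icc_self hx),
      intervalIntegral.integral_congr (by rwa [uIcc_of_le S.L_pos.le])]
  exact (S.below_of_linOp_le hz.1 hz'.1 hz.2.1 hz'.2.1 (linOp_eq.mono fun _ => le_of_eq)).eqOn
    (S.below_of_linOp_le hz'.1 hz.1 hz'.2.1 hz.2.1 (linOp_eq.mono fun _ => ge_of_eq))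

lemma below_step_of_isLowerSolution (hα : IsLowerSolution a b c L p α)
    (hz : IsStep a b c L M N p α z) : Below L α z := by
  rw [isStep_iff] at hz
  refine S.below_of_linOp_le hα.1 hz.1 hα.2.1 hz.2.1 ?_
  filter_upwards [hα.2.2, hz.2.2] with x hαx hzx
  rwa [hzx, ← sub_nonpos, linOp_sub_stepSource, sub_nonpos]

lemma step_below_of_isUpperSolution (hβ : IsUpperSolution a b c L p β)
    (hz : IsStep a b c L M N p β z) : Below L z β := by
  rw [isStep_iff] at hz
  refine S.below_of_linOp_le hz.1 hβ.1 hz.2.1 hβ.2.1 ?_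
  filter_upwards [hβ.2.2, hz.2.2] with x hβx hzx
  rwa [hzx, ← sub_nonneg, linOp_sub_stepSource, sub_nonneg]

theorem exists_isTheIteration (hp : IntegrableOn p (Icc 0 L)) (h₀ : MemW41 L y₀) :
    ∃ y : ℕ → ℝ → ℝ, y 0 = y₀ ∧ IsTheIteration a b c L M N p y₀ y := by
  have exists_step (y : {y // MemW41 L y}) :
      ∃ z : {z // MemW41 L z}, IsStep a b c L M N p y z := by
    obtain ⟨z, hz⟩ := exists_isStep S.L_pos S.M_pos S.N_nonneg hp y.2
    exact ⟨⟨z, hz.1⟩, hz⟩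
  choose T hT using exists_step
  have isStep (n : ℕ) : IsStep a b c L M N p (T^[n] ⟨y₀, h₀⟩) (T^[n + 1] ⟨y₀, h₀⟩) := by
    rw [Function.iterate_succ_apply']
    exact hT _
  refine ⟨fun n => T^[n] ⟨y₀, h₀⟩, rfl, ⟨fun _ _ => rfl, isStep⟩, fun z hz n => ?_⟩
  induction n with
  | zero => exact hz.1
  | succ n ih => exact S.eqOn_of_isStep ih (hz.2 n) (isStep n)

end Admissible

/-- Parameters for which the steps of the iterative procedure are monotone on the functions
below `β`. -/
structure MonotoneSetting (a b c L M N : ℝ) (β : ℝ → ℝ) : Prop extends Admissible L M N where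
  b_nonneg : 0 ≤ b
  memW41 : MemW41 L β
  add_mul_integral_le : a + b * ∫ t in (0 : ℝ)..L, β t ≤ M
  sub_mul_D_two_le : ∀ x ∈ Icc 0 L, c - b * D L 2 β x ≤ N

lemma MonotoneSetting.step_mono {a b c L M N : ℝ} {p u u' v v' β : ℝ → ℝ}
    (S : MonotoneSetting a b c L M N β) (hu : MemW41 L u) (hv : MemW41 L v) (huv : Below L u v)
    (hvβ : Below L v β) (hu' : IsStep a b c L M N p u u') (hv' : IsStep a b c L M N p v v') :
    Below L u' v' := by
  rw [isStep_iff] at hu' hv'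
  refine S.below_of_linOp_le hu'.1 hv'.1 hu'.2.1 hv'.2.1 ?_
  filter_upwards [hu'.2.2, hv'.2.2, ae_restrict_mem measurableSet_Ioo] with x hux hvx hx
  rw [hux, hvx]
  set κ := ∫ t in (0 : ℝ)..L, u t
  set κ' := ∫ t in (0 : ℝ)..L, v t
  have hx' := Ioo_subset_Icc_self hx
  have le_integral : κ ≤ κ' := huv.integral_le S.L_pos hu hv
  have D_two_le : D L 2 v x ≤ D L 2 u x := (huv x hx').2
  have coeff_D_two : a - M + b * κ' ≤ 0 := by
    linarith [mul_le_mul_of_nonneg_left (hvβ.integral_le S.L_pos hv S.memW41) S.b_nonneg,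
      S.add_mul_integral_le]
  have coeff_integral : 0 ≤ N - c + b * D L 2 u x := by
    linarith [mul_le_mul_of_nonneg_left ((huv.trans hvβ) x hx').2 S.b_nonneg,
      S.sub_mul_D_two_le x hx']
  have source_sub : stepSource a b c M N κ' p (D L 2 v) x - stepSource a b c M N κ p (D L 2 u) x
      = (a - M + b * κ') * (D L 2 v x - D L 2 u x) + (κ' - κ) * (N - c + b * D L 2 u x) := by
    simp only [stepSource]
    ring
  rw [← sub_nonneg, source_sub]
  exact add_nonneg (mul_nonneg_of_nonpos_of_nonpos coeff_D_two (sub_nonpos.2 D_two_le))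
    (mul_nonneg (sub_nonneg.2 le_integral) coeff_integral)

/-- Two sequences of the iterative procedure which start at a lower solution `u 0` and at an
upper solution `v 0` above it. -/
structure MonotoneIteration (a b c L M N : ℝ) (p : ℝ → ℝ) (u v : ℕ → ℝ → ℝ) : Prop
    extends MonotoneSetting a b c L M N (v 0) where
  isLowerSolution : IsLowerSolution a b c L p (u 0)
  isUpperSolution : IsUpperSolution a b c L p (v 0)
  below : Below L (u 0) (v 0)
  isStep_lower : ∀ n, IsStep a b c L M N p (u n) (u (n + 1))
  isStep_upper : ∀ n, IsStep a b c L M N p (v n) (v (n + 1))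

section Iteration

variable {a b c L M N : ℝ} {p β w : ℝ → ℝ} {u v : ℕ → ℝ → ℝ}

lemma memW41_of_isStep (h₀ : MemW41 L (u 0)) (hu : ∀ n, IsStep a b c L M N p (u n) (u (n + 1)))
    (n : ℕ) : MemW41 L (u n) :=
  n.casesOn h₀ fun n => (hu n).1

lemma navierBC_of_isStep (h₀ : NavierBC L (u 0))
    (hu : ∀ n, IsStep a b c L M N p (u n) (u (n + 1))) (n : ℕ) : NavierBC L (u n) :=
  n.casesOn h₀ fun n => (hu n).2.1

lemma MonotoneSetting.iterate_mono (S : MonotoneSetting a b c L M N β) (hu₀ : MemW41 L (u 0))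
    (hv₀ : MemW41 L (v 0)) (huv₀ : Below L (u 0) (v 0))
    (hu : ∀ n, IsStep a b c L M N p (u n) (u (n + 1)))
    (hv : ∀ n, IsStep a b c L M N p (v n) (v (n + 1))) (hvβ : ∀ n, Below L (v n) β) (n : ℕ) :
    Below L (u n) (v n) := by
  induction n with
  | zero => exact huv₀
  | succ n ih =>
    exact S.step_mono (memW41_of_isStep hu₀ hu n) (memW41_of_isStep hv₀ hv n) ih (hvβ n) (hu n)
      (hv n)

namespace MonotoneIteration

variable (I : MonotoneIteration a b c L M N p u v)

include I

lemma memW41_lower (n : ℕ) : MemW41 L (u n) :=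
  memW41_of_isStep I.isLowerSolution.1 I.isStep_lower n

lemma memW41_upper (n : ℕ) : MemW41 L (v n) :=
  memW41_of_isStep I.isUpperSolution.1 I.isStep_upper n

lemma upper_succ_below_and_below_zero (n : ℕ) :
    Below L (v (n + 1)) (v n) ∧ Below L (v n) (v 0) := by
  induction n with
  | zero => exact ⟨I.step_below_of_isUpperSolution I.isUpperSolution (I.isStep_upper 0),
      refl_of (Below L) (v 0)⟩
  | succ n ih => exact ⟨I.step_mono (I.memW41_upper (n + 1)) (I.memW41_upper n) ih.1 ih.2
      (I.isStep_upper (n + 1)) (I.isStep_upper n), ih.1.trans ih.2⟩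

lemma upper_succ_below (n : ℕ) : Below L (v (n + 1)) (v n) :=
  (I.upper_succ_below_and_below_zero n).1

lemma upper_below_zero (n : ℕ) : Below L (v n) (v 0) :=
  (I.upper_succ_below_and_below_zero n).2

lemma lower_below_upper (n : ℕ) : Below L (u n) (v n) :=
  I.iterate_mono I.isLowerSolution.1 I.isUpperSolution.1 I.below I.isStep_lower I.isStep_upper
    I.upper_below_zero n

lemma lower_below_upper_zero (n : ℕ) : Below L (u n) (v 0) :=
  (I.lower_below_upper n).trans (I.upper_below_zero n)

lemma lower_below_succ (n : ℕ) : Below L (u n) (u (n + 1)) :=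
  I.iterate_mono (v := fun n => u (n + 1)) I.isLowerSolution.1 (I.memW41_lower 1)
    (I.below_step_of_isLowerSolution I.isLowerSolution (I.isStep_lower 0)) I.isStep_lower
    (fun n => I.isStep_lower (n + 1)) (fun n => I.lower_below_upper_zero (n + 1)) n

lemma lower_zero_below (n : ℕ) : Below L (u 0) (u n) :=
  Nat.rel_of_forall_rel_succ_of_le (Below L) I.lower_below_succ n.zero_le

lemma lower_zero_below_upper (n : ℕ) : Below L (u 0) (v n) :=
  (I.lower_zero_below n).trans (I.lower_below_upper n)

lemma lower_below_of_isSolution (hw : IsSolution a b c L p w) (hαw : Below L (u 0) w)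
    (hwβ : Below L w (v 0)) (n : ℕ) : Below L (u n) w :=
  I.iterate_mono (v := fun _ => w) I.isLowerSolution.1 hw.1 hαw I.isStep_lower
    (fun _ => isStep_self_iff.2 hw) (fun _ => hwβ) n

lemma below_upper_of_isSolution (hw : IsSolution a b c L p w) (hwβ : Below L w (v 0)) (n : ℕ) :
    Below L w (v n) :=
  I.iterate_mono (u := fun _ => w) hw.1 I.isUpperSolution.1 hwβ (fun _ => isStep_self_iff.2 hw)
    I.isStep_upper I.upper_below_zero n

end MonotoneIteration

end Iteration

section DominatedConvergence

variable {L B : ℝ} {F : ℕ → ℝ → ℝ} {f : ℝ → ℝ}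

lemma intervalIntegrable_of_tendsto_of_bounded (hL : 0 ≤ L)
    (hF : ∀ n, IntervalIntegrable (F n) volume 0 L) (hB : ∀ n, ∀ x ∈ Icc 0 L, |F n x| ≤ B)
    (hf : ∀ x ∈ Icc 0 L, Tendsto (fun n => F n x) atTop (𝓝 (f x))) :
    IntervalIntegrable f volume 0 L := by
  have hmem : ∀ᵐ x ∂volume.restrict (uIoc 0 L), x ∈ Icc 0 L := by
    rw [uIoc_of_le hL]
    exact (ae_restrict_mem measurableSet_Ioc).mono fun _ hx => Ioc_subset_Icc_self hx
  refine (intervalIntegrable_const (c := B)).mono_fun (aestronglyMeasurable_of_tendsto_ae atTop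
    (fun n => (hF n).aestronglyMeasurable_restrict_uIoc) (hmem.mono hf)) (hmem.mono fun x hx => ?_)
  exact (le_of_tendsto' (hf x hx).abs fun n => hB n x hx).trans (le_abs_self B)

lemma tendsto_integral_of_bounded (hL : 0 ≤ L)
    (hF : ∀ n, IntervalIntegrable (F n) volume 0 L) (hB : ∀ n, ∀ x ∈ Icc 0 L, |F n x| ≤ B)
    (hf : ∀ x ∈ Icc 0 L, Tendsto (fun n => F n x) atTop (𝓝 (f x))) :
    Tendsto (fun n => ∫ x in (0 : ℝ)..L, F n x) atTop (𝓝 (∫ x in (0 : ℝ)..L, f x)) := by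
  have hmem {x : ℝ} (hx : x ∈ uIoc 0 L) : x ∈ Icc 0 L := by
    rw [uIoc_of_le hL] at hx
    exact Ioc_subset_Icc_self hx
  exact intervalIntegral.tendsto_integral_filter_of_dominated_convergence (fun _ => B)
    (Eventually.of_forall fun n => (hF n).aestronglyMeasurable_restrict_uIoc)
    (Eventually.of_forall fun n => ae_of_all _ fun x hx => hB n x (hmem hx))
    intervalIntegrable_const (ae_of_all _ fun x hx => hf x (hmem hx))

lemma tendsto_integral_abs_sub (hL : 0 ≤ L)
    (hF : ∀ n, IntervalIntegrable (F n) volume 0 L) (hB : ∀ n, ∀ x ∈ Icc 0 L, |F n x| ≤ B)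
    (hf : ∀ x ∈ Icc 0 L, Tendsto (fun n => F n x) atTop (𝓝 (f x))) :
    Tendsto (fun n => ∫ x in (0 : ℝ)..L, |F n x - f x|) atTop (𝓝 0) := by
  have hfi := intervalIntegrable_of_tendsto_of_bounded hL hF hB hf
  have hfB : ∀ x ∈ Icc 0 L, |f x| ≤ B := fun x hx =>
    le_of_tendsto' (hf x hx).abs fun n => hB n x hx
  have key := tendsto_integral_of_bounded (F := fun n x => |F n x - f x|) (f := fun _ => 0)
    (B := B + B) hL (fun n => ((hF n).sub hfi).abs) (fun n x hx => ?_) fun x hx => ?_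
  · rwa [intervalIntegral.integral_zero] at key
  · rw [abs_abs]
    exact (abs_sub _ _).trans (add_le_add (hB n x hx) (hfB x hx))
  · simpa only [sub_self, abs_zero] using ((hf x hx).sub_const (f x)).abs

lemma integral_abs_stepSource_sub_le {a b c M N κ κ' : ℝ} {p v v' : ℝ → ℝ} (hL : 0 ≤ L)
    (hv : IntervalIntegrable v volume 0 L) (hv' : IntervalIntegrable v' volume 0 L) :
    ∫ x in (0 : ℝ)..L, |stepSource a b c M N κ p v x - stepSource a b c M N κ' p v' x|
      ≤ |a - M + b * κ| * (∫ x in (0 : ℝ)..L, |v x - v' x|)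
        + |κ - κ'| * ∫ x in (0 : ℝ)..L, |b * v' x + (N - c)| := by
  have source_sub (x : ℝ) : stepSource a b c M N κ p v x - stepSource a b c M N κ' p v' x
      = (a - M + b * κ) * (v x - v' x) + (κ - κ') * (b * v' x + (N - c)) := by
    simp only [stepSource]
    ring
  have int₁ := (hv.sub hv').const_mul (a - M + b * κ)
  have int₂ := ((hv'.const_mul b).add (intervalIntegrable_const (c := N - c))).const_mul (κ - κ')
  simp only [source_sub]
  refine (intervalIntegral.integral_mono_on hL (int₁.add int₂).abs (int₁.abs.add int₂.abs)
    fun _ _ => abs_add_le _ _).trans_eq ?_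
  rw [intervalIntegral.integral_add int₁.abs int₂.abs]
  simp only [abs_mul, intervalIntegral.integral_const_mul]

lemma tendsto_integral_abs_stepSource_sub {a b c M N κ : ℝ} {κs : ℕ → ℝ} {p : ℝ → ℝ}
    (hL : 0 ≤ L) (hκ : Tendsto κs atTop (𝓝 κ)) (hF : ∀ n, IntervalIntegrable (F n) volume 0 L)
    (hf : IntervalIntegrable f volume 0 L)
    (h : Tendsto (fun n => ∫ x in (0 : ℝ)..L, |F n x - f x|) atTop (𝓝 0)) :
    Tendsto (fun n => ∫ x in (0 : ℝ)..L,
      |stepSource a b c M N (κs n) p (F n) x - stepSource a b c M N κ p f x|) atTop (𝓝 0) := by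
  refine squeeze_zero (fun n => intervalIntegral.integral_nonneg hL fun _ _ => abs_nonneg _)
    (fun n => integral_abs_stepSource_sub_le hL (hF n) hf) ?_
  simpa using (((hκ.const_mul b).const_add (a - M)).abs.mul h).add
    ((hκ.sub_const κ).abs.mul_const _)

end DominatedConvergence

lemma tendstoUniformlyOn_of_abs_sub_le {s : Set ℝ} {F : ℕ → ℝ → ℝ} {f : ℝ → ℝ} {δ : ℕ → ℝ}
    (hδ : Tendsto δ atTop (𝓝 0)) (h : ∀ n, ∀ x ∈ s, |F n x - f x| ≤ δ n) :
    TendstoUniformlyOn F f atTop s := by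
  rw [Metric.tendstoUniformlyOn_iff]
  intro ε hε
  filter_upwards [hδ.eventually_lt_const hε] with n hn x hx
  rw [dist_comm]
  exact (h n x hx).trans_lt hn

lemma tendstoUniformlyOn_of_succ {s : Set ℝ} {F : ℕ → ℝ → ℝ} {f : ℝ → ℝ}
    (h : TendstoUniformlyOn (fun n => F (n + 1)) f atTop s) : TendstoUniformlyOn F f atTop s :=
  fun u hu => by
    rw [← map_add_atTop_eq_nat 1]
    exact h u hu

section Convergence

variable {a b c L M N B : ℝ} {p z : ℝ → ℝ} {y : ℕ → ℝ → ℝ}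

theorem tendstoUniformlyOn_of_tendsto_integral_linOp (hL : 0 < L) (hM : 0 < M) (hN : 0 ≤ N)
    (hy : ∀ n, MemW41 L (y n)) (hby : ∀ n, NavierBC L (y n)) (hz : MemW41 L z)
    (hbz : NavierBC L z)
    (h : Tendsto (fun n => ∫ t in (0 : ℝ)..L, |linOp M N L (y n) t - linOp M N L z t|) atTop
      (𝓝 0)) :
    TendstoUniformlyOn y z atTop (Icc 0 L) ∧
      TendstoUniformlyOn (fun n => D L 2 (y n)) (D L 2 z) atTop (Icc 0 L) := by
  obtain ⟨B, hB⟩ := exists_abs_D_two_le_integral_abs_linOp hL hM hN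
  have hd (n : ℕ) := (hy n).sub hL hz
  have hbd (n : ℕ) := (hby n).sub hL (hy n) hz hbz
  let δ (n : ℕ) := B * ∫ t in (0 : ℝ)..L, |linOp M N L (y n) t - linOp M N L z t|
  have hδ : Tendsto δ atTop (𝓝 0) := by simpa using h.const_mul B
  have abs_D_two_le (n : ℕ) : ∀ x ∈ Icc 0 L, |D L 2 (y n - z) x| ≤ δ n := fun x hx => by
    refine (hB _ (hd n) (hbd n) x hx).trans_eq (congrArg (B * ·) ?_)
    exact integral_congr_ae_Ioo hL.le ((linOp_sub hL (hy n) hz).mono fun t ht => by rw [ht])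
  have abs_le (n : ℕ) : ∀ x ∈ Icc 0 L, |(y n - z) x| ≤ L ^ 2 / 8 * δ n := fun x hx =>
    abs_le_of_abs_D_two_le hL (hd n) (hbd n) (abs_D_two_le n) hx
  refine ⟨tendstoUniformlyOn_of_abs_sub_le (by simpa using hδ.const_mul (L ^ 2 / 8)) abs_le,
    tendstoUniformlyOn_of_abs_sub_le hδ fun n x hx => ?_⟩
  rw [← (hy n).D_sub hL hz (by norm_num) hx]
  exact abs_D_two_le n x hx

lemma tendsto_integral_of_tendsto_D_two {f : ℝ → ℝ} (hL : 0 < L) (hy : ∀ n, MemW41 L (y n))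
    (hby : ∀ n, NavierBC L (y n)) (hB : ∀ n, ∀ x ∈ Icc 0 L, |D L 2 (y n) x| ≤ B)
    (hf : ∀ x ∈ Icc 0 L, Tendsto (fun n => D L 2 (y n) x) atTop (𝓝 (f x))) :
    Tendsto (fun n => ∫ t in (0 : ℝ)..L, y n t) atTop
      (𝓝 (-∫ x in (0 : ℝ)..L, f x * (x * (L - x) / 2))) := by
  have integral_eq (n : ℕ) : ∫ t in (0 : ℝ)..L, y n t
      = -∫ x in (0 : ℝ)..L, D L 2 (y n) x * (x * (L - x) / 2) := by
    rw [integral_D_two_mul_parabola hL (hy n) (hby n), neg_neg]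
  simp only [integral_eq]
  refine (tendsto_integral_of_bounded (B := B * (L ^ 2 / 8)) hL.le (fun n => ?_)
    (fun n x hx => ?_) fun x hx => (hf x hx).mul_const _).neg
  · exact ((hy n).intervalIntegrable_D hL (by norm_num)).mul_continuousOn (by fun_prop)
  · have parabola_nonneg : 0 ≤ x * (L - x) / 2 := by
      have := mul_nonneg hx.1 (sub_nonneg.2 hx.2)
      positivity
    rw [abs_mul, abs_of_nonneg parabola_nonneg]
    exact mul_le_mul (hB n x hx) (by linarith [sq_nonneg (L - 2 * x)]) parabola_nonneg
      ((abs_nonneg _).trans (hB n x hx))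

lemma isSolution_of_linOp_eq_stepSource {f : ℝ → ℝ} (hL : 0 < L) (hz : MemW41 L z)
    (hbz : NavierBC L z) (hf : EqOn f (D L 2 z) (Icc 0 L))
    (h : ∀ᵐ x ∂volume.restrict (Ioo 0 L), linOp M N L z x
      = stepSource a b c M N (-∫ t in (0 : ℝ)..L, f t * (t * (L - t) / 2)) p f x) :
    IsSolution a b c L p z := by
  have integral_z : -∫ t in (0 : ℝ)..L, f t * (t * (L - t) / 2) = ∫ t in (0 : ℝ)..L, z t := by
    rw [← neg_eq_iff_eq_neg.2 (integral_D_two_mul_parabola hL hz hbz)]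
    refine congrArg _ (intervalIntegral.integral_congr fun x hx => ?_)
    rw [uIcc_of_le hL.le] at hx
    simp only [hf hx]
  rw [← isStep_self_iff (M := M) (N := N), isStep_iff]
  refine ⟨hz, hbz, ?_⟩
  filter_upwards [h, ae_restrict_mem measurableSet_Ioo] with x hzx hx
  rw [hzx, integral_z, stepSource, stepSource, hf (Ioo_subset_Icc_self hx)]

theorem exists_isSolution_tendstoUniformlyOn (hL : 0 < L) (hM : 0 < M) (hN : 0 ≤ N)
    (hp : IntegrableOn p (Icc 0 L)) (hy₀ : MemW41 L (y 0)) (hby₀ : NavierBC L (y 0))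
    (hstep : ∀ n, IsStep a b c L M N p (y n) (y (n + 1)))
    (hB : ∀ n, ∀ x ∈ Icc 0 L, |D L 2 (y n) x| ≤ B)
    (hlim : ∀ x ∈ Icc 0 L, ∃ l, Tendsto (fun n => D L 2 (y n) x) atTop (𝓝 l)) :
    ∃ z, IsSolution a b c L p z ∧ TendstoUniformlyOn y z atTop (Icc 0 L) ∧
      TendstoUniformlyOn (fun n => D L 2 (y n)) (D L 2 z) atTop (Icc 0 L) := by
  choose! f hf using hlim
  have hy := memW41_of_isStep hy₀ hstep
  have hby := navierBC_of_isStep hby₀ hstep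
  have hDy (n : ℕ) := (hy n).intervalIntegrable_D hL (k := 2) (by norm_num)
  have hfi := intervalIntegrable_of_tendsto_of_bounded hL.le hDy hB hf
  obtain ⟨z, hz, hbz, linOp_z⟩ := exists_linOp_eq hL hM hN (intervalIntegrable_stepSource
    (a := a) (b := b) (c := c) (M := M) (N := N)
    (κ := -∫ x in (0 : ℝ)..L, f x * (x * (L - x) / 2)) hL hp hfi)
  have tendsto_source := tendsto_integral_abs_stepSource_sub (a := a) (b := b) (c := c) (M := M)
    (N := N) (p := p) hL.le (tendsto_integral_of_tendsto_D_two hL hy hby hB hf) hDy hfi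
    (tendsto_integral_abs_sub hL.le hDy hB hf)
  obtain ⟨tendsto_succ, tendsto_D_succ⟩ := tendstoUniformlyOn_of_tendsto_integral_linOp
    (y := fun n => y (n + 1)) hL hM hN (fun n => hy (n + 1)) (fun n => hby (n + 1)) hz hbz
    (tendsto_source.congr fun n => integral_congr_ae_Ioo hL.le (by
      filter_upwards [(isStep_iff.1 (hstep n)).2.2, linOp_z] with x hyx hzx
      rw [hyx, hzx]))
  have tendsto_D := tendstoUniformlyOn_of_succ (F := fun n => D L 2 (y n)) tendsto_D_succ
  exact ⟨z, isSolution_of_linOp_eq_stepSource hL hz hbz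
      (fun x hx => tendsto_nhds_unique (hf x hx) (tendsto_D.tendsto_at hx)) linOp_z,
    tendstoUniformlyOn_of_succ tendsto_succ, tendsto_D⟩

end Convergence

section Extremal

variable {a b c L M N : ℝ} {p α β w z : ℝ → ℝ} {y u v : ℕ → ℝ → ℝ}

lemma below_of_tendstoUniformlyOn (hy : TendstoUniformlyOn y z atTop (Icc 0 L))
    (hD : TendstoUniformlyOn (fun n => D L 2 (y n)) (D L 2 z) atTop (Icc 0 L))
    (h : ∀ n, Below L (y n) w) : Below L z w := fun _ hx =>
  ⟨le_of_tendsto' (hy.tendsto_at hx) fun n => (h n _ hx).1,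
    ge_of_tendsto' (hD.tendsto_at hx) fun n => (h n _ hx).2⟩

lemma above_of_tendstoUniformlyOn (hy : TendstoUniformlyOn y z atTop (Icc 0 L))
    (hD : TendstoUniformlyOn (fun n => D L 2 (y n)) (D L 2 z) atTop (Icc 0 L))
    (h : ∀ n, Below L w (y n)) : Below L w z := fun _ hx =>
  ⟨ge_of_tendsto' (hy.tendsto_at hx) fun n => (h n _ hx).1,
    le_of_tendsto' (hD.tendsto_at hx) fun n => (h n _ hx).2⟩

lemma exists_abs_D_two_le_of_below (hL : 0 < L) (hα : MemW41 L α) (hβ : MemW41 L β) :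
    ∃ B, ∀ w, Below L α w → Below L w β → ∀ x ∈ Icc 0 L, |D L 2 w x| ≤ B := by
  obtain ⟨A, hA⟩ := isCompact_Icc.exists_bound_of_continuousOn
    (hα.continuousOn_D hL (k := 2) (by norm_num))
  obtain ⟨B, hB⟩ := isCompact_Icc.exists_bound_of_continuousOn
    (hβ.continuousOn_D hL (k := 2) (by norm_num))
  exact ⟨max A B, fun w hαw hwβ x hx =>
    (abs_le_max_abs_abs (hwβ x hx).2 (hαw x hx).2).trans ((max_comm _ _).trans_le
      (max_le_max (hA x hx) (hB x hx)))⟩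

namespace MonotoneIteration

variable (I : MonotoneIteration a b c L M N p u v) (hp : IntegrableOn p (Icc 0 L))

include I hp

theorem exists_isMinSolution :
    ∃ y, IsMinSolution a b c L p (u 0) (v 0) y ∧ TendstoUniformlyOn u y atTop (Icc 0 L) := by
  obtain ⟨B, hB⟩ := exists_abs_D_two_le_of_below I.L_pos I.isLowerSolution.1 I.isUpperSolution.1
  obtain ⟨y, hy, tendsto_u, tendsto_D⟩ := exists_isSolution_tendstoUniformlyOn I.L_pos I.M_pos
    I.N_nonneg hp I.isLowerSolution.1 I.isLowerSolution.2.1 I.isStep_lower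
    (fun n => hB _ (I.lower_zero_below n) (I.lower_below_upper_zero n)) fun x hx =>
      ⟨_, tendsto_atTop_ciInf (antitone_nat_of_succ_le fun n => (I.lower_below_succ n x hx).2)
        ⟨_, forall_mem_range.2 fun n => (I.lower_below_upper_zero n x hx).2⟩⟩
  exact ⟨y, ⟨hy, ⟨hy.1.1.of_le (by norm_num),
      above_of_tendstoUniformlyOn tendsto_u tendsto_D I.lower_zero_below,
      below_of_tendstoUniformlyOn tendsto_u tendsto_D I.lower_below_upper_zero⟩,
    fun w hw hwS => below_of_tendstoUniformlyOn tendsto_u tendsto_D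
      (I.lower_below_of_isSolution hw hwS.2.1 hwS.2.2)⟩, tendsto_u⟩

theorem exists_isMaxSolution :
    ∃ y, IsMaxSolution a b c L p (u 0) (v 0) y ∧ TendstoUniformlyOn v y atTop (Icc 0 L) := by
  obtain ⟨B, hB⟩ := exists_abs_D_two_le_of_below I.L_pos I.isLowerSolution.1 I.isUpperSolution.1
  obtain ⟨y, hy, tendsto_v, tendsto_D⟩ := exists_isSolution_tendstoUniformlyOn I.L_pos I.M_pos
    I.N_nonneg hp I.isUpperSolution.1 I.isUpperSolution.2.1 I.isStep_upper
    (fun n => hB _ (I.lower_zero_below_upper n) (I.upper_below_zero n)) fun x hx =>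
      ⟨_, tendsto_atTop_ciSup (monotone_nat_of_le_succ fun n => (I.upper_succ_below n x hx).2)
        ⟨_, forall_mem_range.2 fun n => (I.lower_zero_below_upper n x hx).2⟩⟩
  exact ⟨y, ⟨hy, ⟨hy.1.1.of_le (by norm_num),
      above_of_tendstoUniformlyOn tendsto_v tendsto_D I.lower_zero_below_upper,
      below_of_tendstoUniformlyOn tendsto_v tendsto_D I.upper_below_zero⟩,
    fun w hw hwS => above_of_tendstoUniformlyOn tendsto_v tendsto_D
      (I.below_upper_of_isSolution hw hwS.2.2)⟩, tendsto_v⟩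

end MonotoneIteration

theorem MonotoneSetting.exists_extremal_solutions (S : MonotoneSetting a b c L M N β)
    (hp : IntegrableOn p (Icc 0 L)) (hα : IsLowerSolution a b c L p α)
    (hβ : IsUpperSolution a b c L p β) (hαβ : Below L α β) :
    ∃ (αs βs : ℕ → ℝ → ℝ) (yMin yMax : ℝ → ℝ),
      IsTheIteration a b c L M N p α αs ∧ IsTheIteration a b c L M N p β βs ∧
      (∀ n, Below L (αs n) (αs (n + 1)) ∧ Below L (αs n) (βs n) ∧
        Below L (βs (n + 1)) (βs n)) ∧
      IsMinSolution a b c L p α β yMin ∧ IsMaxSolution a b c L p α β yMax ∧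
      TendstoUniformlyOn αs yMin atTop (Icc 0 L) ∧
      TendstoUniformlyOn βs yMax atTop (Icc 0 L) := by
  obtain ⟨αs, rfl, hαs⟩ := S.exists_isTheIteration (a := a) (b := b) (c := c) hp hα.1
  obtain ⟨βs, rfl, hβs⟩ := S.exists_isTheIteration (a := a) (b := b) (c := c) hp hβ.1
  have I : MonotoneIteration a b c L M N p αs βs := ⟨S, hα, hβ, hαβ, hαs.1.2, hβs.1.2⟩
  obtain ⟨yMin, hyMin, tendsto_yMin⟩ := I.exists_isMinSolution hp
  obtain ⟨yMax, hyMax, tendsto_yMax⟩ := I.exists_isMaxSolution hp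
  exact ⟨αs, βs, yMin, yMax, hαs, hβs,
    fun n => ⟨I.lower_below_succ n, I.lower_below_upper n, I.upper_succ_below n⟩,
    hyMin, hyMax, tendsto_yMin, tendsto_yMax⟩

end Extremal

/-! ### The first eigenmode as an upper solution -/

/-- The first eigenmode `r sin (π x / L)` of the simply supported beam. -/
noncomputable def sineProfile (L r x : ℝ) : ℝ := r * Real.sin (Real.pi / L * x)

section SineProfile

variable {a b c L r x : ℝ} {p : ℝ → ℝ}

lemma contDiff_sineProfile (L r : ℝ) {n : WithTop ℕ∞} : ContDiff ℝ n (sineProfile L r) := by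
  unfold sineProfile
  fun_prop

lemma memW41_sineProfile (hL : 0 < L) (r : ℝ) : MemW41 L (sineProfile L r) :=
  memW41_of_contDiffOn hL (contDiff_sineProfile L r).contDiffOn

lemma D_two_mul_sineProfile (hL : 0 < L) (r : ℝ) (k : ℕ) (hx : x ∈ Icc 0 L) :
    D L (2 * k) (sineProfile L r) x = (-(Real.pi / L) ^ 2) ^ k * sineProfile L r x := by
  rw [D_eq_iteratedDeriv hL (contDiff_sineProfile L r) hx]
  unfold sineProfile
  rw [iteratedDeriv_const_mul_field, iteratedDeriv_comp_const_mul Real.contDiff_sin,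
    Real.iteratedDeriv_even_sin]
  simp only [Pi.mul_apply, Pi.pow_apply, Pi.neg_apply, Pi.one_apply, pow_mul]
  rw [neg_pow]
  ring

lemma D_two_sineProfile (hL : 0 < L) (r : ℝ) (hx : x ∈ Icc 0 L) :
    D L 2 (sineProfile L r) x = -(Real.pi / L) ^ 2 * sineProfile L r x := by
  rw [D_two_mul_sineProfile hL r 1 hx, pow_one]

lemma sineProfile_zero (L r : ℝ) : sineProfile L r 0 = 0 := by simp [sineProfile]

lemma sineProfile_self (hL : 0 < L) (r : ℝ) : sineProfile L r L = 0 := by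
  simp [sineProfile, div_mul_cancel₀ _ hL.ne']

lemma navierBC_sineProfile (hL : 0 < L) (r : ℝ) : NavierBC L (sineProfile L r) := by
  refine ⟨sineProfile_zero L r, sineProfile_self hL r, ?_, ?_⟩
  · rw [D_two_sineProfile hL r (left_mem_Icc.2 hL.le), sineProfile_zero, mul_zero]
  · rw [D_two_sineProfile hL r (right_mem_Icc.2 hL.le), sineProfile_self hL, mul_zero]

lemma integral_sineProfile (hL : 0 < L) (r : ℝ) :
    ∫ x in (0 : ℝ)..L, sineProfile L r x = 2 * r * L / Real.pi := by
  have hπ := Real.pi_pos.ne'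
  simp only [sineProfile]
  rw [intervalIntegral.integral_const_mul, intervalIntegral.integral_comp_mul_left Real.sin
    (div_ne_zero hπ hL.ne'), integral_sin, div_mul_cancel₀ _ hL.ne', mul_zero, Real.cos_zero,
    Real.cos_pi, smul_eq_mul]
  field

lemma sineProfile_nonneg (hL : 0 < L) (hr : 0 ≤ r) (hx : x ∈ Icc 0 L) : 0 ≤ sineProfile L r x := by
  refine mul_nonneg hr (Real.sin_nonneg_of_nonneg_of_le_pi
    (mul_nonneg (div_pos Real.pi_pos hL).le hx.1) ?_)
  calc Real.pi / L * x ≤ Real.pi / L * L :=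
        mul_le_mul_of_nonneg_left hx.2 (div_pos Real.pi_pos hL).le
    _ = Real.pi := div_mul_cancel₀ _ hL.ne'

lemma isLeast_D_two_sineProfile (hL : 0 < L) (hr : 0 ≤ r) :
    IsLeast (D L 2 (sineProfile L r) '' Icc 0 L) (-(r * (Real.pi / L) ^ 2)) := by
  constructor
  · have half_mem : L / 2 ∈ Icc 0 L := ⟨by linarith, by linarith⟩
    have sine_half : Real.sin (Real.pi / L * (L / 2)) = 1 := by
      rw [← Real.sin_pi_div_two]
      congr 1
      field
    refine ⟨L / 2, half_mem, ?_⟩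
    rw [D_two_sineProfile hL r half_mem, sineProfile, sine_half]
    ring
  · rintro _ ⟨x, hx, rfl⟩
    have le_amplitude : sineProfile L r x ≤ r :=
      mul_le_of_le_one_right hr (Real.sin_le_one _)
    rw [D_two_sineProfile hL r hx, neg_mul, mul_comm r]
    gcongr

lemma D_const_zero (L : ℝ) (k : ℕ) (x : ℝ) : D L k (fun _ => 0) x = 0 := by
  rw [D, iteratedDerivWithin_fun_const_zero]

lemma below_zero_sineProfile (hL : 0 < L) (hr : 0 ≤ r) :
    Below L (fun _ => 0) (sineProfile L r) := fun x hx => by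
  have h := sineProfile_nonneg hL hr hx
  refine ⟨h, ?_⟩
  rw [D_two_sineProfile hL r hx, D_const_zero, neg_mul]
  exact neg_nonpos.2 (by positivity)

lemma isLowerSolution_zero (hL : 0 < L) (hp : ∀ᵐ x ∂volume.restrict (Ioo 0 L), 0 ≤ p x) :
    IsLowerSolution a b c L p (fun _ => 0) := by
  refine ⟨memW41_of_contDiffOn hL contDiffOn_const, ⟨rfl, rfl, ?_, ?_⟩, hp.mono fun x hx => ?_⟩
  · rw [D_const_zero]
  · rw [D_const_zero]
  · simpa [melanOp, D_const_zero] using hx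

lemma isUpperSolution_sineProfile (hL : 0 < L)
    (hp : ∀ᵐ x ∂volume.restrict (Ioo 0 L),
      p x ≤ (r * Real.pi ^ 4 / L ^ 4 + a * r * Real.pi ^ 2 / L ^ 2
          + 2 * b * r ^ 2 * Real.pi / L) * Real.sin (Real.pi / L * x)
        + 2 * r * c * L / Real.pi) : IsUpperSolution a b c L p (sineProfile L r) := by
  refine ⟨memW41_sineProfile hL r, navierBC_sineProfile hL r, ?_⟩
  filter_upwards [hp, ae_restrict_mem measurableSet_Ioo] with x hpx hx
  refine hpx.trans_eq ?_
  have hx' := Ioo_subset_Icc_self hx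
  have hπ := Real.pi_pos.ne'
  rw [melanOp, D_two_sineProfile hL r hx', D_two_mul_sineProfile hL r 2 hx',
    integral_sineProfile hL, sineProfile]
  field

end SineProfile

end Melan

theorem theorem5p1_general (L a b c lam M N : ℝ) (p β : ℝ → ℝ)
    (hL : 0 < L) (hb : 0 ≤ b) (hlam : 0 ≤ lam) (hM₀ : 0 < M) (hN₀ : 0 ≤ N)
    (hp : IntegrableOn p (Icc 0 L))
    (hp0 : ∀ᵐ x ∂volume.restrict (Ioo 0 L), 0 ≤ p x)
    (hp1 : ∀ᵐ x ∂volume.restrict (Ioo 0 L),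
      p x ≤ (lam * Real.pi ^ 4 / L ^ 4 + a * lam * Real.pi ^ 2 / L ^ 2
          + 2 * b * lam ^ 2 * Real.pi / L) * Real.sin (Real.pi / L * x)
        + 2 * lam * c * L / Real.pi)
    (hβ : β = fun x => lam * Real.sin (Real.pi / L * x))
    (hM : M = a + 2 * b * lam * L / Real.pi)
    (hN : N = c + b * lam * Real.pi ^ 2 / L ^ 2)
    (hMN : N ≤ 4 * M / L ^ 3 * Melan.sigma (Real.sqrt M * L)) :
    Melan.IsLowerSolution a b c L p (fun _ => 0) ∧
    Melan.IsUpperSolution a b c L p β ∧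
    M = a + b * (∫ x in (0 : ℝ)..L, β x) ∧
    (∃ m, IsLeast (Melan.D L 2 β '' Icc 0 L) m ∧ N = c - b * m) ∧
    ∃ (αs βs : ℕ → ℝ → ℝ) (yMin yMax : ℝ → ℝ),
      Melan.IsTheIteration a b c L M N p (fun _ => 0) αs ∧
      Melan.IsTheIteration a b c L M N p β βs ∧
      (∀ n, Melan.Below L (αs n) (αs (n + 1)) ∧ Melan.Below L (αs n) (βs n) ∧
        Melan.Below L (βs (n + 1)) (βs n)) ∧
      Melan.IsMinSolution a b c L p (fun _ => 0) β yMin ∧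
      Melan.IsMaxSolution a b c L p (fun _ => 0) β yMax ∧
      TendstoUniformlyOn αs yMin atTop (Icc 0 L) ∧
      TendstoUniformlyOn βs yMax atTop (Icc 0 L) := by
  obtain rfl : β = Melan.sineProfile L lam := hβ
  have lower := Melan.isLowerSolution_zero (a := a) (b := b) (c := c) hL hp0
  have upper := Melan.isUpperSolution_sineProfile hL hp1
  have least := Melan.isLeast_D_two_sineProfile hL hlam
  have M_eq : M = a + b * ∫ x in (0 : ℝ)..L, Melan.sineProfile L lam x := by
    rw [Melan.integral_sineProfile hL, hM]
    ring
  have N_eq : N = c - b * -(lam * (Real.pi / L) ^ 2) := by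
    rw [hN]
    ring
  have S : Melan.MonotoneSetting a b c L M N (Melan.sineProfile L lam) :=
    ⟨⟨hL, hM₀, hN₀, hMN⟩, hb, upper.1, M_eq.ge, fun x hx => by
      rw [N_eq]
      gcongr
      exact least.2 (mem_image_of_mem _ hx)⟩
  exact ⟨lower, upper, M_eq, ⟨_, least, N_eq⟩,
    S.exists_extremal_solutions hp lower upper (Melan.below_zero_sineProfile hL hlam)⟩

theorem theorem5p1 (L a b c lam M N : ℝ) (p β : ℝ → ℝ)
    (hL : 0 < L) (ha : 0 < a) (hb : 0 < b) (hc : 0 < c) (hlam : 0 < lam)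
    (hp : IntegrableOn p (Icc 0 L))
    (hp0 : ∀ᵐ x ∂volume.restrict (Ioo 0 L), 0 ≤ p x)
    (hp1 : ∀ᵐ x ∂volume.restrict (Ioo 0 L),
      p x ≤ (lam * Real.pi ^ 4 / L ^ 4 + a * lam * Real.pi ^ 2 / L ^ 2
          + 2 * b * lam ^ 2 * Real.pi / L) * Real.sin (Real.pi / L * x)
        + 2 * lam * c * L / Real.pi)
    (hβ : β = fun x => lam * Real.sin (Real.pi / L * x))
    (hM : M = a + 2 * b * lam * L / Real.pi)
    (hN : N = c + b * lam * Real.pi ^ 2 / L ^ 2)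
    (hMN : N ≤ 4 * M / L ^ 3 * Melan.sigma (Real.sqrt M * L)) :
    Melan.IsLowerSolution a b c L p (fun _ => 0) ∧
    Melan.IsUpperSolution a b c L p β ∧
    M = a + b * (∫ x in (0 : ℝ)..L, β x) ∧
    (∃ m, IsLeast (Melan.D L 2 β '' Icc 0 L) m ∧ N = c - b * m) ∧
    ∃ (αs βs : ℕ → ℝ → ℝ) (yMin yMax : ℝ → ℝ),
      Melan.IsTheIteration a b c L M N p (fun _ => 0) αs ∧
      Melan.IsTheIteration a b c L M N p β βs ∧
      (∀ n, Melan.Below L (αs n) (αs (n + 1)) ∧ Melan.Below L (αs n) (βs n) ∧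
        Melan.Below L (βs (n + 1)) (βs n)) ∧
      Melan.IsMinSolution a b c L p (fun _ => 0) β yMin ∧
      Melan.IsMaxSolution a b c L p (fun _ => 0) β yMax ∧
      TendstoUniformlyOn αs yMin atTop (Icc 0 L) ∧
      TendstoUniformlyOn βs yMax atTop (Icc 0 L) :=
  theorem5p1_general L a b c lam M N p β hL hb.le hlam.le (hM ▸ by positivity)
    (hN ▸ by positivity) hp hp0 hp1 hβ hM hN hMN
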